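/- Let $n,m\ge 0$ be integers. For complex $m\times m$ matrices $A_1,\dots,A_n,B_1,\dots,B_n$ let $$Q=\sum_{j=1}^n A_j\,\partial_j+B(x),\qquad B(x)=\sum_{j=1}^n x_jB_j,$$ regarded as an unbounded operator on $L^2(\mathbb R^n,\mathbb C^m)$ whose domain is the space $C_c^\infty(\mathbb R^n,\mathbb C^m)$ of compactly supported smooth functions. Let $\mathcal H$ be the Hilbert space obtained by completing $C_c^\infty(\mathbb R^n,\mathbb C^m)$ in the harmonic oscillator norm $$\|u\|_{\mathcal H}^2=\|u\|_{L^2}^2+\sum_{j=1}^n\|\partial_ju\|_{L^2}^2+\sum_{j=1}^n\|x_ju\|_{L^2}^2 ,$$ with the canonical map $\mathcal H\to L^2(\mathbb R^n,\mathbb C^m)$ extending the inclusion of $C_c^\infty$. (a) Suppose that 1. $\sum_j A_j\partial_j$ is elliptic, i.e. $\sum_j\xi_jA_j$ is invertible for every nonzero $\xi\in\mathbb R^n$; 2. there is a constant $K>0$ such that $B(x)^*B(x)\ge K|x|^2\,\mathbf 1$ for all $x\in\mathbb R^n$; 3. $A_j^*B_k-B_k^*A_j=0$ for all $j,k$. Then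 $Q$ is closable, the canonical map $\mathcal H\to L^2$ is injective, the domain of the closure $\overline Q$ is (the image of) $\mathcal H$, and $\overline Q:\mathcal H\to L^2(\mathbb R^n,\mathbb C^m)$ is a bounded Fredholm operator. (b) Let $A_j(t),B_j(t)$ ($1\le j\le n$, $t\in[0,1]$) be continuous families of complex $m\times m$ matrices such that for every $t$ the matrices $\sum_jx_jA_j(t)$ and $\sum_jx_jB_j(t)$ are invertible for all nonzero $x\in\mathbb R^n$ and $A_j(t)^*B_k(t)-B_k(t)^*A_j(t)=0$ for all $j,k$. Let $Q_t=\sum_jA_j(t)\partial_j+\sum_jx_jB_j(t)$. Then, for every $t\in[0,1]$, $Q_t$ is closable and its closure is a bounded Fredholm operator $\mathcal H\to L^2(\mathbb R^n,\mathbb C^m)$ with domain $\mathcal H$ (so its index is defined), and the index $$\operatorname{ind}(\overline{Q_t})=\dim\ker\overline{Q_t}-\dim\big(L^2(\mathbb R^n,\mathbb C^m)/\operatorname{ran}\overline{Q_t}\big)$$ is independent of $t\in[0,1]$. -/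

import Mathlib

open scoped Matrix ContDiff ComplexOrder
open MeasureTheory

noncomputable section

namespace LocalIndex

/-- The space `ℝⁿ` with its Euclidean norm and Lebesgue measure. -/
abbrev Rn (n : ℕ) : Type := EuclideanSpace ℝ (Fin n)

/-- The space `ℂᵐ` with its Hermitian norm. -/
abbrev Cm (m : ℕ) : Type := EuclideanSpace ℂ (Fin m)

/-- The Hilbert space `L²(ℝⁿ, ℂᵐ)`. -/
abbrev L2 (n m : ℕ) : Type := Lp (Cm m) 2 (volume : Measure (Rn n))

/-- The matrix `∑ⱼ xⱼ Mⱼ`. -/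
def pencil {n m : ℕ} (M : Fin n → Matrix (Fin m) (Fin m) ℂ) (x : Rn n) :
    Matrix (Fin m) (Fin m) ℂ :=
  ∑ j, (x j : ℂ) • M j

/-- Ellipticity of the constant coefficient operator `∑ⱼ Aⱼ ∂ⱼ`: its principal symbol
`i ∑ⱼ ξⱼ Aⱼ` is invertible for every nonzero covector `ξ` (the factor `i` is irrelevant). -/
def IsElliptic {n m : ℕ} (A : Fin n → Matrix (Fin m) (Fin m) ℂ) : Prop :=
  ∀ ξ : Rn n, ξ ≠ 0 → IsUnit (pencil A ξ)

/-- The space of compactly supported smooth functions `ℝⁿ → ℂᵐ`. -/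
def testFunctions (n m : ℕ) : Submodule ℂ (Rn n → Cm m) where
  carrier := {u | ContDiff ℝ ∞ u ∧ HasCompactSupport u}
  zero_mem' := ⟨contDiff_const, HasCompactSupport.zero⟩
  add_mem' := fun hu hv => ⟨hu.1.add hv.1, hu.2.add hv.2⟩
  smul_mem' := fun c _ hu => ⟨hu.1.const_smul c, hu.2.smul_left (f := fun _ => c)⟩

theorem testFunctions_memLp {n m : ℕ} (u : testFunctions n m) :
    MemLp (u : Rn n → Cm m) 2 volume :=
  u.2.1.continuous.memLp_of_hasCompactSupport u.2.2

/-- The class in `L²` of a compactly supported smooth function. -/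
def toL2 (n m : ℕ) : testFunctions n m →ₗ[ℂ] L2 n m where
  toFun u := (testFunctions_memLp u).toLp
  map_add' _ _ := rfl
  map_smul' _ _ := rfl

theorem toL2_injective (n m : ℕ) : Function.Injective (toL2 n m) := by
  intro u v h
  have h2 := (MemLp.toLp_eq_toLp_iff (testFunctions_memLp u) (testFunctions_memLp v)).1 h
  exact Subtype.ext ((Continuous.ae_eq_iff_eq volume u.2.1.continuous v.2.1.continuous).1 h2)

/-- The partial derivative `∂ⱼ` on compactly supported smooth functions. -/
def partialD {n m : ℕ} (j : Fin n) : testFunctions n m →ₗ[ℂ] testFunctions n m where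
  toFun u := ⟨fun x => fderiv ℝ (u : Rn n → Cm m) x (EuclideanSpace.single j 1),
    (u.2.1.fderiv_right (m := ∞) (by simp)).clm_apply contDiff_const,
    u.2.2.fderiv_apply (𝕜 := ℝ) _⟩
  map_add' u v := by
    ext1
    funext x
    have hu := (u.2.1.differentiable (by simp)).differentiableAt (x := x)
    have hv := (v.2.1.differentiable (by simp)).differentiableAt (x := x)
    simp [fderiv_add hu hv]
  map_smul' c u := by
    ext1
    funext x
    have hu := (u.2.1.differentiable (by simp)).differentiableAt (x := x)
    simp [fderiv_const_smul hu c]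

/-- Multiplication by the coordinate function `xⱼ` on compactly supported smooth functions. -/
def mulCoord {n m : ℕ} (j : Fin n) : testFunctions n m →ₗ[ℂ] testFunctions n m where
  toFun u := ⟨fun x => x j • (u : Rn n → Cm m) x,
    ContDiff.smul (f := fun x : Rn n => x j) (by fun_prop) u.2.1, u.2.2.smul_left (f := fun x : Rn n => x j)⟩
  map_add' u v := by
    ext1
    funext x
    simp
  map_smul' c u := by
    ext1
    funext x
    exact smul_comm (x j) c _

/-- Pointwise application of a constant matrix on compactly supported smooth functions. -/
def mulMat {n m : ℕ} (M : Matrix (Fin m) (Fin m) ℂ) :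
    testFunctions n m →ₗ[ℂ] testFunctions n m where
  toFun u := ⟨fun x => Matrix.toEuclideanCLM (𝕜 := ℂ) M ((u : Rn n → Cm m) x),
    ((Matrix.toEuclideanCLM (𝕜 := ℂ) M).restrictScalars ℝ).contDiff.comp u.2.1,
    u.2.2.comp_left (map_zero _)⟩
  map_add' u v := by
    ext1
    funext x
    simp
  map_smul' c u := by
    ext1
    funext x
    simp

/-- The operator `∑ⱼ Aⱼ ∂ⱼ + ∑ⱼ xⱼ Bⱼ` on compactly supported smooth functions. -/
def opTest {n m : ℕ} (A B : Fin n → Matrix (Fin m) (Fin m) ℂ) :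
    testFunctions n m →ₗ[ℂ] testFunctions n m :=
  ∑ j, mulMat (A j) ∘ₗ partialD j + ∑ j, mulCoord j ∘ₗ mulMat (B j)

/-- The unbounded operator `Q = ∑ⱼ Aⱼ ∂ⱼ + ∑ⱼ xⱼ Bⱼ` on `L²(ℝⁿ, ℂᵐ)`, whose domain is the space
of (classes of) compactly supported smooth functions. -/
def opQ {n m : ℕ} (A B : Fin n → Matrix (Fin m) (Fin m) ℂ) : L2 n m →ₗ.[ℂ] L2 n m where
  domain := LinearMap.range (toL2 n m)
  toFun := toL2 n m ∘ₗ opTest A B ∘ₗ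
    (LinearEquiv.ofInjective (toL2 n m) (toL2_injective n m)).symm.toLinearMap

/-- The map `u ↦ (u, (∂ⱼ u)ⱼ, (xⱼ u)ⱼ)` into a Hilbert sum of `2n + 1` copies of `L²`. The norm of
the image is the harmonic oscillator norm of `u`:
`‖u‖² = ‖u‖²_{L²} + ∑ⱼ ‖∂ⱼ u‖²_{L²} + ∑ⱼ ‖xⱼ u‖²_{L²}`. -/
def oscMap (n m : ℕ) :
    testFunctions n m →ₗ[ℂ] PiLp 2 (fun _ : Option (Fin n ⊕ Fin n) => L2 n m) :=
  (WithLp.linearEquiv 2 ℂ (Option (Fin n ⊕ Fin n) → L2 n m)).symm.toLinearMap ∘ₗ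
    LinearMap.pi (fun i => match i with
      | none => toL2 n m
      | some (Sum.inl j) => toL2 n m ∘ₗ partialD j
      | some (Sum.inr j) => toL2 n m ∘ₗ mulCoord j)

/-- The Hilbert space `ℋ`: the closure (completion) of the space of compactly supported smooth
functions with respect to the harmonic oscillator norm, realised as the closure of the isometric
copy of that space given by `oscMap`. -/
def OscSpace (n m : ℕ) : Submodule ℂ (PiLp 2 (fun _ : Option (Fin n ⊕ Fin n) => L2 n m)) :=
  (LinearMap.range (oscMap n m)).topologicalClosure

/-- The canonical map `ℋ → L²`, the continuous extension of the inclusion of the compactly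
supported smooth functions. -/
def oscToL2 (n m : ℕ) : OscSpace n m →L[ℂ] L2 n m :=
  (PiLp.proj 2 (fun _ : Option (Fin n ⊕ Fin n) => L2 n m) none : _ →L[ℂ] L2 n m) ∘L
    (OscSpace n m).subtypeL

/-- The operator `T` on `L²` has domain `ℋ` (regarded as a subspace of `L²` through the canonical
map, which is injective) and is a bounded Fredholm operator from `ℋ`, with the harmonic oscillator
norm, to `L²`. -/
def IsFredholmOnOsc {n m : ℕ} (T : L2 n m →ₗ.[ℂ] L2 n m) : Prop :=
  Function.Injective (oscToL2 n m) ∧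
  T.domain = LinearMap.range (oscToL2 n m).toLinearMap ∧
  ∃ S : OscSpace n m →L[ℂ] L2 n m,
    (∀ (w : OscSpace n m) (hw : oscToL2 n m w ∈ T.domain), S w = T ⟨oscToL2 n m w, hw⟩) ∧
    S.IsFredholm

/-- The index `dim ker T - dim coker T` of an unbounded operator (meaningful when both dimensions
are finite). -/
def index {n m : ℕ} (T : L2 n m →ₗ.[ℂ] L2 n m) : ℤ :=
  (Module.finrank ℂ (LinearMap.ker T.toFun) : ℤ) -
    (Module.finrank ℂ (L2 n m ⧸ LinearMap.range T.toFun) : ℤ)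

end LocalIndex

end

/-!
The proof works in phase space, through the windowed Fourier transform
`V_g u (q, p) = ∫ exp (-2πi ⟨x, p⟩) g (x - q) u x dx` with a fixed real window `g` in `C_c^∞`.
By Plancherel's theorem `V_g` multiplies `L²` norms by the constant `‖g‖` (`eLpNorm_stft`), and it
turns `Q` into multiplication by the full symbol `σ(q, p) = 2πi A(p) + B(q)`, up to terms in which a
derivative or a coordinate falls on the window and which are bounded by `‖u‖` (`WeakEq.stft_eq`).
This holds for all distributional solutions of `Q v = f` with `v, f ∈ L²`.

The commutation hypothesis says that `A(p)* B(q)` is self-adjoint, so that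
`σ* σ = 4π² A(p)* A(p) + B(q)* B(q)` and `σ(q, p)` is invertible for `(q, p) ≠ 0`
(`isotropicElliptic`). The symbol is homogeneous of degree one, whence `|σ(z) v| ≥ c |z| |v|`, and
`|z| V_g v` is controlled in `L²` by `‖Q v‖ + ‖v‖`. Since `|z| V_g u` controls the `L²` norms of
`∂ⱼ u` and `xⱼ u`, this is the a priori estimate `‖u‖_ℋ ≤ C (‖Q u‖ + ‖u‖)`, which identifies the
closure of `Q` with its extension to `ℋ` (`IsotropicElliptic.closure_graph`).

For the Fredholm property, `z ↦ V_g v(z)` is equicontinuous on balls and its tail is controlled by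
`|z| V_g v`. Hence on a subspace of `L²` of finite codimension the norm of `v` is absorbed by
`|z| V_g v` (`exists_cofg_norm_le`, a form of Rellich's theorem), and there `‖v‖ ≤ C ‖Q v‖`. This
makes the kernel finite-dimensional and the range closed. The orthogonal complement of the range
consists of the distributional solutions in `L²` of the formal adjoint equation, whose symbol `σ*`
is invertible too, so the same bound shows that it is finite-dimensional. The formal adjoint need
not satisfy the commutation hypothesis; only the invertibility of its symbol matters.

The index is locally constant in operator norm (`eventually_linIndex_eq`), and the operators
`ℋ → L²` depend continuously in norm on the coefficients, so it is constant along a family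
parametrised by a connected space.
-/

noncomputable section

namespace LocalIndex

open Filter Topology
open scoped FourierTransform SchwartzMap

variable {n m : ℕ}

/-! ### Windows and wave packets -/

/-- Real-valued compactly supported smooth functions, used as windows. -/
structure Window (n : ℕ) where
  /-- The underlying function. -/
  toFun : Rn n → ℝ
  smooth : ContDiff ℝ ∞ toFun
  compact : HasCompactSupport toFun

namespace Window

/-- The window `∂ₖ g`. -/
def deriv (g : Window n) (k : Fin n) : Window n where
  toFun x := fderiv ℝ g.toFun x (EuclideanSpace.single k 1)
  smooth := (g.smooth.fderiv_right (m := ∞) (by simp)).clm_apply contDiff_const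
  compact := g.compact.fderiv_apply (𝕜 := ℝ) _

/-- The window `xₖ g`. -/
def mul (g : Window n) (k : Fin n) : Window n where
  toFun x := x k * g.toFun x
  smooth := ContDiff.mul (f := fun x : Rn n => x k) (by fun_prop) g.smooth
  compact := g.compact.mul_left (f := fun x : Rn n => x k)

/-- The `L²` norm of a window. -/
def l2norm (g : Window n) : ℝ := (eLpNorm g.toFun 2 volume).toReal

theorem memLp (g : Window n) : MemLp g.toFun 2 volume :=
  g.smooth.continuous.memLp_of_hasCompactSupport g.compact

theorem l2norm_nonneg (g : Window n) : 0 ≤ g.l2norm := ENNReal.toReal_nonneg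

theorem ofReal_l2norm (g : Window n) : ENNReal.ofReal g.l2norm = eLpNorm g.toFun 2 volume :=
  ENNReal.ofReal_toReal g.memLp.eLpNorm_ne_top

theorem exists_l2norm_pos (n : ℕ) : ∃ g : Window n, 0 < g.l2norm := by
  let f : ContDiffBump (0 : Rn n) := ⟨1, 2, by norm_num, by norm_num⟩
  let g : Window n := ⟨f, f.contDiff, f.hasCompactSupport⟩
  refine ⟨g, ENNReal.toReal_pos ?_ g.memLp.eLpNorm_ne_top⟩
  rw [Ne, eLpNorm_eq_zero_iff g.memLp.1 (by norm_num)]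
  intro h
  have h2 := (Continuous.ae_eq_iff_eq volume g.smooth.continuous continuous_const).1 h
  have h3 : f 0 = 0 := congrFun h2 0
  have h4 : f 0 = 1 := f.one_of_mem_closedBall (by simp [f.rIn_pos.le])
  linarith

end Window

/-- The phase `exp (2πi ⟨x, p⟩)`. -/
def phase (p x : Rn n) : ℂ := Complex.exp ((2 * Real.pi * inner ℝ x p : ℝ) * Complex.I)

theorem norm_phase (p x : Rn n) : ‖phase p x‖ = 1 := Complex.norm_exp_ofReal_mul_I _

theorem contDiff_phase (p : Rn n) : ContDiff ℝ ∞ (phase p) := by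
  unfold phase
  have h : ContDiff ℝ ∞ fun x : Rn n => 2 * Real.pi * inner ℝ x p :=
    contDiff_const.mul (contDiff_id.inner ℝ contDiff_const)
  exact ((Complex.ofRealCLM.contDiff.comp h).mul contDiff_const).cexp

/-- The wave packet `x ↦ exp (2πi ⟨x, p⟩) g (x - q) e` centred at `z = (q, p)` in phase space. -/
def packet (g : Window n) (z : Rn n × Rn n) : Cm m →ₗ[ℂ] testFunctions n m where
  toFun e := ⟨fun x => (phase z.2 x * (g.toFun (x - z.1) : ℂ)) • e,
    ((contDiff_phase z.2).mul (Complex.ofRealCLM.contDiff.comp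
      (g.smooth.comp (contDiff_id.sub contDiff_const)))).smul contDiff_const, by
      have h : HasCompactSupport fun x => g.toFun (x - z.1) :=
        g.compact.comp_homeomorph (Homeomorph.subRight z.1)
      have h2 : HasCompactSupport fun x => (g.toFun (x - z.1) : ℂ) :=
        h.comp_left Complex.ofReal_zero
      exact (h2.mul_left (f := phase z.2)).smul_right (f' := fun _ => e)⟩
  map_add' e e' := by ext1; funext x; simp
  map_smul' c e := by ext1; funext x; simp [smul_comm c]

theorem packet_apply (g : Window n) (z : Rn n × Rn n) (e : Cm m) (x : Rn n) :
    (packet g z e : Rn n → Cm m) x = (phase z.2 x * (g.toFun (x - z.1) : ℂ)) • e := rfl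

theorem mulMat_packet (M : Matrix (Fin m) (Fin m) ℂ) (g : Window n) (z : Rn n × Rn n)
    (e : Cm m) :
    mulMat M (packet g z e) = packet g z (Matrix.toEuclideanCLM (𝕜 := ℂ) M e) := by
  ext1; funext x
  simp [mulMat, packet_apply]

theorem mulCoord_packet (k : Fin n) (g : Window n) (z : Rn n × Rn n) (e : Cm m) :
    mulCoord k (packet g z e) = packet g z ((z.1 k : ℂ) • e) + packet (g.mul k) z e := by
  ext1; funext x
  simp only [mulCoord, LinearMap.coe_mk, AddHom.coe_mk, packet_apply, Submodule.coe_add,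
    Pi.add_apply, Window.mul]
  rw [smul_smul, ← add_smul, ← Complex.coe_smul, smul_smul]
  congr 1
  simp
  ring

theorem hasFDerivAt_phase (p x : Rn n) :
    HasFDerivAt (phase p)
      (phase p x • (2 * Real.pi * Complex.I) • (Complex.ofRealCLM.comp (innerSL ℝ p))) x := by
  have h1 : HasFDerivAt (fun x : Rn n => ((inner ℝ p x : ℝ) : ℂ))
    (Complex.ofRealCLM.comp (innerSL ℝ p)) x :=
    (Complex.ofRealCLM.comp (innerSL ℝ p)).hasFDerivAt
  have h2 := (h1.const_mul (2 * Real.pi * Complex.I)).cexp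
  have e1 : phase p = fun x => Complex.exp (2 * Real.pi * Complex.I * ((inner ℝ p x : ℝ) : ℂ)) := by
    funext y
    rw [phase, real_inner_comm]
    congr 1
    push_cast
    ring
  rw [e1]
  exact h2

theorem partialD_packet (k : Fin n) (g : Window n) (z : Rn n × Rn n) (e : Cm m) :
    partialD k (packet g z e) =
      packet g z ((2 * Real.pi * Complex.I * (z.2 k : ℂ)) • e) + packet (g.deriv k) z e := by
  ext1; funext x
  have h1 := hasFDerivAt_phase z.2 x
  have hg : HasFDerivAt g.toFun (fderiv ℝ g.toFun (x - z.1)) (x - z.1) :=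
    (g.smooth.differentiable (by simp)).differentiableAt.hasFDerivAt
  have h2 : HasFDerivAt (fun x => (g.toFun (x - z.1) : ℂ))
      (Complex.ofRealCLM.comp (fderiv ℝ g.toFun (x - z.1))) x :=
    Complex.ofRealCLM.hasFDerivAt.comp x (hg.comp x ((hasFDerivAt_id x).sub_const z.1))
  have h3 := (h1.mul h2).smul_const e
  change fderiv ℝ (fun x => (phase z.2 x * (g.toFun (x - z.1) : ℂ)) • e) x
    (EuclideanSpace.single k 1) = _
  erw [h3.fderiv]
  simp only [packet_apply, Submodule.coe_add, Pi.add_apply, Window.deriv]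
  rw [ContinuousLinearMap.smulRight_apply, smul_smul _ _ e, ← add_smul]
  congr 1
  simp [EuclideanSpace.inner_single_right]
  ring

/-- The matrix `M` as a continuous linear map. -/
abbrev mat (M : Matrix (Fin m) (Fin m) ℂ) : Cm m →L[ℂ] Cm m := Matrix.toEuclideanCLM (𝕜 := ℂ) M

/-- The symbol `∑ₖ 2πi pₖ Aₖ + ∑ₖ qₖ Bₖ` of `∑ₖ Aₖ ∂ₖ + ∑ₖ xₖ Bₖ` at `(q, p)`. -/
def sym (A B : Fin n → Matrix (Fin m) (Fin m) ℂ) (z : Rn n × Rn n) : Cm m →L[ℂ] Cm m :=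
  ∑ k, (2 * Real.pi * Complex.I * (z.2 k : ℂ)) • mat (A k) + ∑ k, (z.1 k : ℂ) • mat (B k)

theorem opTest_packet (A B : Fin n → Matrix (Fin m) (Fin m) ℂ) (g : Window n)
    (z : Rn n × Rn n) (e : Cm m) :
    opTest A B (packet g z e) = packet g z (sym A B z e) +
      (∑ k, packet (g.deriv k) z (mat (A k) e) + ∑ k, packet (g.mul k) z (mat (B k) e)) := by
  simp only [opTest, LinearMap.add_apply, LinearMap.sum_apply, LinearMap.comp_apply,
    partialD_packet, mulMat_packet, mulCoord_packet, map_add, sym, add_apply,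
    sum_apply, map_sum, Finset.sum_add_distrib, smul_apply,
    map_smul]
  abel

/-! ### The windowed Fourier transform -/

theorem denseRange_toL2 (n m : ℕ) : DenseRange (toL2 n m) := by
  have h := Lp.dense_hasCompactSupport_contDiff (E := Rn n) (F := Cm m) (p := 2)
    (μ := volume) (by norm_num)
  refine h.mono ?_
  rintro f ⟨g, hfg, hg, hg'⟩
  refine ⟨⟨g, hg', hg⟩, ?_⟩
  exact Lp.ext ((testFunctions_memLp ⟨g, hg', hg⟩).coeFn_toLp.trans hfg.symm)

theorem inner_toL2_left (φ : testFunctions n m) (u : L2 n m) :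
    inner ℂ (toL2 n m φ) u = ∫ x, inner ℂ ((φ : Rn n → Cm m) x) (u x) := by
  rw [L2.inner_def]
  refine integral_congr_ae ?_
  filter_upwards [(testFunctions_memLp φ).coeFn_toLp] with x hx
  congr 1

theorem inner_toL2_toL2 (φ u : testFunctions n m) :
    inner ℂ (toL2 n m φ) (toL2 n m u) =
      ∫ x, inner ℂ ((φ : Rn n → Cm m) x) ((u : Rn n → Cm m) x) := by
  rw [inner_toL2_left]
  refine integral_congr_ae ?_
  filter_upwards [(testFunctions_memLp u).coeFn_toLp] with x hx
  congr 1

theorem norm_toL2 (φ : testFunctions n m) :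
    ‖toL2 n m φ‖ = (eLpNorm (φ : Rn n → Cm m) 2 volume).toReal :=
  Lp.norm_toLp _ (testFunctions_memLp φ)

theorem eLpNorm_two_sq {α E : Type*} [MeasurableSpace α] [NormedAddCommGroup E] (μ : Measure α)
    (f : α → E) : eLpNorm f 2 μ ^ 2 = ∫⁻ x, ‖f x‖ₑ ^ 2 ∂μ := by
  have := eLpNorm_nnreal_pow_eq_lintegral (f := f) (μ := μ) (p := 2) (by norm_num)
  simpa using this

theorem eLpNorm_translate (g : Window n) (q : Rn n) :
    eLpNorm (fun x => g.toFun (x - q)) 2 volume = eLpNorm g.toFun 2 volume :=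
  eLpNorm_comp_measurePreserving g.memLp.1 (measurePreserving_sub_right volume q)

theorem norm_toL2_packet (g : Window n) (z : Rn n × Rn n) (e : Cm m) :
    ‖toL2 n m (packet g z e)‖ = g.l2norm * ‖e‖ := by
  have h : eLpNorm (packet g z e : Rn n → Cm m) 2 volume =
      eLpNorm (‖e‖ • fun x => g.toFun (x - z.1)) 2 volume := by
    refine eLpNorm_congr_norm_ae (ae_of_all _ fun x => ?_)
    simp [packet_apply, norm_smul, norm_phase, mul_comm]
  rw [norm_toL2, h, eLpNorm_const_smul, eLpNorm_translate, ENNReal.toReal_mul, mul_comm]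
  simp [Window.l2norm]

/-- The map `e ↦ packet g z e` into `L²`. -/
def packetL (g : Window n) (z : Rn n × Rn n) : Cm m →L[ℂ] L2 n m :=
  LinearMap.toContinuousLinearMap (toL2 n m ∘ₗ packet g z)

theorem packetL_apply (g : Window n) (z : Rn n × Rn n) (e : Cm m) :
    packetL g z e = toL2 n m (packet g z e) := rfl

theorem continuous_inner_packetL (g : Window n) (e : Cm m) (φ : testFunctions n m) :
    Continuous fun z => inner ℂ (toL2 n m φ) (packetL g z e) := by
  simp_rw [packetL_apply, inner_toL2_toL2]
  obtain ⟨C, hC⟩ := g.compact.exists_bound_of_continuous g.smooth.continuous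
  refine continuous_of_dominated (bound := fun x => ‖(φ : Rn n → Cm m) x‖ * (C * ‖e‖))
    ?_ ?_ ?_ ?_
  · intro z
    exact (φ.2.1.continuous.inner (packet g z e).2.1.continuous).aestronglyMeasurable
  · intro z
    refine ae_of_all _ fun x => (norm_inner_le_norm _ _).trans ?_
    gcongr
    rw [packet_apply, norm_smul, norm_mul, norm_phase, one_mul, Complex.norm_real]
    gcongr
    exact hC _
  · exact (φ.2.1.continuous.norm.integrable_of_hasCompactSupport φ.2.2.norm).mul_const _
  · refine ae_of_all _ fun x => ?_
    have h1 : Continuous fun z : Rn n × Rn n => phase z.2 x := by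
      unfold phase
      fun_prop
    have h2 : Continuous fun z : Rn n × Rn n => (g.toFun (x - z.1) : ℂ) :=
      Complex.continuous_ofReal.comp (g.smooth.continuous.comp (by fun_prop))
    exact continuous_const.inner ((h1.mul h2).smul continuous_const)

/-- Packets have a norm independent of `z`, so their weak continuity in `z` gives strong
continuity. -/
theorem continuous_packetL (g : Window n) :
    Continuous fun z => (packetL g z : Cm m →L[ℂ] L2 n m) := by
  refine continuous_clm_apply.2 fun e => continuous_iff_continuousAt.2 fun z₀ => ?_
  rw [ContinuousAt, tendsto_iff_norm_sub_tendsto_zero]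
  have hc := (Complex.continuous_re.comp
    (continuous_inner_packetL g e (packet g z₀ e))).tendsto z₀
  have h2 : ∀ z, ‖packetL g z e - packetL g z₀ e‖ =
      Real.sqrt (2 * (g.l2norm * ‖e‖) ^ 2
        - 2 * (inner ℂ (toL2 n m (packet g z₀ e)) (packetL g z e)).re) := by
    intro z
    rw [← Real.sqrt_sq (norm_nonneg _), @norm_sub_sq ℂ]
    congr 1
    rw [packetL_apply, packetL_apply, norm_toL2_packet, norm_toL2_packet]
    have h : RCLike.re (inner ℂ (toL2 n m (packet g z e)) (toL2 n m (packet g z₀ e))) =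
        (inner ℂ (toL2 n m (packet g z₀ e)) (toL2 n m (packet g z e))).re := inner_re_symm _ _
    rw [h]
    ring
  have h0 : inner ℂ (toL2 n m (packet g z₀ e)) (packetL g z₀ e) = ((g.l2norm * ‖e‖) ^ 2 : ℝ) := by
    rw [packetL_apply, inner_self_eq_norm_sq_to_K, norm_toL2_packet]
    simp
  have h3 := ((hc.const_mul 2).const_sub (2 * (g.l2norm * ‖e‖) ^ 2)).sqrt
  rw [Function.comp_apply, h0, Complex.ofReal_re, sub_self, Real.sqrt_zero] at h3
  simp_rw [h2]
  exact h3

/-- The windowed Fourier transform `V_g u (q, p) = ∫ exp (-2πi ⟨x, p⟩) g (x - q) u x dx`, defined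
by duality with wave packets so that it makes sense pointwise for every `u ∈ L²`. -/
def stft (g : Window n) (u : L2 n m) (z : Rn n × Rn n) : Cm m :=
  ContinuousLinearMap.adjoint (packetL g z) u

theorem inner_stft (g : Window n) (u : L2 n m) (z : Rn n × Rn n) (e : Cm m) :
    inner ℂ e (stft g u z) = inner ℂ (toL2 n m (packet g z e)) u :=
  ContinuousLinearMap.adjoint_inner_right _ _ _

theorem continuous_adjoint_packetL (g : Window n) :
    Continuous fun z => ContinuousLinearMap.adjoint (packetL g z : Cm m →L[ℂ] L2 n m) :=
  ContinuousLinearMap.adjoint.continuous.comp (continuous_packetL g)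

theorem continuous_stft (g : Window n) (u : L2 n m) : Continuous (stft g u) :=
  (continuous_adjoint_packetL g).clm_apply continuous_const

theorem stft_sub (g : Window n) (u v : L2 n m) :
    stft g (u - v) = stft g u - stft g v := by
  funext z; simp [stft]

/-- The localised function `x ↦ g (x - q) u x`. -/
def localized (g : Window n) (u : testFunctions n m) (q : Rn n) : 𝓢(Rn n, Cm m) :=
  HasCompactSupport.toSchwartzMap (f := fun x => (g.toFun (x - q)) • (u : Rn n → Cm m) x)
    (u.2.2.smul_left (f := fun x => g.toFun (x - q)))
    ((g.smooth.comp (contDiff_id.sub contDiff_const)).smul u.2.1)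

theorem localized_apply (g : Window n) (u : testFunctions n m) (q x : Rn n) :
    localized g u q x = (g.toFun (x - q)) • (u : Rn n → Cm m) x := rfl

theorem stft_toL2 (g : Window n) (u : testFunctions n m) (q p : Rn n) :
    stft g (toL2 n m u) (q, p) = 𝓕 (localized g u q) p := by
  refine ext_inner_left ℂ fun e => ?_
  rw [inner_stft, inner_toL2_toL2, SchwartzMap.fourier_coe, Real.fourier_eq]
  have hi : Integrable fun v => Real.fourierChar (-inner ℝ v p) • localized g u q v := by
    simpa using (Real.fourierIntegral_convergent_iff p).2 (localized g u q).integrable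
  rw [← integral_inner hi]
  refine integral_congr_ae (ae_of_all _ fun x => ?_)
  simp only [packet_apply, localized_apply, Circle.smul_def, Real.fourierChar_apply]
  rw [inner_smul_left, inner_smul_right, ← Complex.coe_smul, inner_smul_right, phase,
    map_mul, ← Complex.exp_conj, ← mul_assoc]
  have h : (starRingEnd ℂ) ((2 * Real.pi * inner ℝ x p : ℝ) * Complex.I) =
      (2 * Real.pi * -inner ℝ x p : ℝ) * Complex.I := by
    rw [map_mul, Complex.conj_ofReal, Complex.conj_I]
    push_cast
    ring
  rw [h, Complex.conj_ofReal]

theorem eLpNorm_fourier (f : 𝓢(Rn n, Cm m)) :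
    eLpNorm (𝓕 f : 𝓢(Rn n, Cm m)) 2 volume = eLpNorm f 2 volume := by
  have h := SchwartzMap.norm_fourier_toL2_eq f
  rw [SchwartzMap.norm_toLp, SchwartzMap.norm_toLp] at h
  exact (ENNReal.toReal_eq_toReal_iff' ((𝓕 f).memLp 2 volume).eLpNorm_ne_top
    (f.memLp 2 volume).eLpNorm_ne_top).1 h

/-- Moyal's identity for test functions: Plancherel in `p`, then Tonelli in `q`. -/
theorem eLpNorm_stft_toL2 (g : Window n) (u : testFunctions n m) :
    eLpNorm (stft g (toL2 n m u)) 2 volume = ENNReal.ofReal (g.l2norm * ‖toL2 n m u‖) := by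
  rw [ENNReal.ofReal_mul g.l2norm_nonneg, g.ofReal_l2norm, norm_toL2,
    ENNReal.ofReal_toReal (testFunctions_memLp u).eLpNorm_ne_top]
  refine (ENNReal.pow_right_strictMono two_ne_zero).injective ?_
  rw [mul_pow, eLpNorm_two_sq, eLpNorm_two_sq _ (u : Rn n → Cm m), Measure.volume_eq_prod,
    lintegral_prod _ (by
      exact ((continuous_stft g _).enorm.measurable.pow_const 2).aemeasurable)]
  have h1 : ∀ q, ∫⁻ p, ‖stft g (toL2 n m u) (q, p)‖ₑ ^ 2 =
      ∫⁻ x, ‖g.toFun (x - q)‖ₑ ^ 2 * ‖(u : Rn n → Cm m) x‖ₑ ^ 2 := by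
    intro q
    simp_rw [stft_toL2]
    rw [← eLpNorm_two_sq, eLpNorm_fourier, eLpNorm_two_sq]
    simp_rw [localized_apply, enorm_smul, mul_pow]
  simp_rw [h1]
  have hg := g.smooth.continuous
  have hu := u.2.1.continuous
  rw [lintegral_lintegral_swap (by
    refine Measurable.aemeasurable ?_
    refine Measurable.mul (f := fun z : Rn n × Rn n => ‖g.toFun (z.2 - z.1)‖ₑ ^ 2)
      (g := fun z : Rn n × Rn n => ‖(u : Rn n → Cm m) z.2‖ₑ ^ 2) ?_ ?_
    · exact ((hg.comp (continuous_snd.sub continuous_fst)).enorm.measurable).pow_const 2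
    · exact ((hu.comp continuous_snd).enorm.measurable).pow_const 2)]
  rw [← lintegral_const_mul _ (hu.enorm.measurable.pow_const 2)]
  refine lintegral_congr fun x => ?_
  have hgx : Continuous fun q => g.toFun (x - q) := hg.comp (by fun_prop)
  rw [lintegral_mul_const _ (hgx.enorm.measurable.pow_const 2), eLpNorm_two_sq]
  congr 1
  exact lintegral_sub_left_eq_self (fun q => ‖g.toFun q‖ₑ ^ 2) x

theorem aestronglyMeasurable_stft (g : Window n) (u : L2 n m) :
    AEStronglyMeasurable (stft g u) volume := (continuous_stft g u).aestronglyMeasurable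

theorem exists_toL2_tendsto (u : L2 n m) :
    ∃ v : ℕ → testFunctions n m, Tendsto (fun k => toL2 n m (v k)) atTop (𝓝 u) := by
  obtain ⟨x, hx, hxu⟩ := mem_closure_iff_seq_limit.1 (denseRange_toL2 n m u)
  choose v hv using hx
  exact ⟨v, by simpa only [hv] using hxu⟩

/-- Moyal's identity: the windowed Fourier transform multiplies `L²` norms by the norm of the
window. -/
theorem eLpNorm_stft (g : Window n) (u : L2 n m) :
    eLpNorm (stft g u) 2 volume = ENNReal.ofReal (g.l2norm * ‖u‖) := by
  have hle : ∀ u : L2 n m, eLpNorm (stft g u) 2 volume ≤ ENNReal.ofReal (g.l2norm * ‖u‖) := by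
    intro u
    obtain ⟨v, hv⟩ := exists_toL2_tendsto u
    -- Fatou's lemma along an approximating sequence of test functions
    refine (Lp.eLpNorm_lim_le_liminf_eLpNorm
      (fun k => aestronglyMeasurable_stft g (toL2 n m (v k))) _ (ae_of_all _ fun z =>
        ((ContinuousLinearMap.adjoint (packetL g z)).continuous.tendsto u).comp hv)).trans ?_
    simp_rw [eLpNorm_stft_toL2]
    exact (ENNReal.tendsto_ofReal (hv.norm.const_mul _)).liminf_eq.le
  refine le_antisymm (hle u) ?_
  -- the upper bound applied to `v k - u` shows that no norm is lost in the limit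
  obtain ⟨v, hv⟩ := exists_toL2_tendsto u
  have h1 : Tendsto (fun k => eLpNorm (stft g u) 2 volume +
      ENNReal.ofReal (g.l2norm * ‖toL2 n m (v k) - u‖)) atTop
      (𝓝 (eLpNorm (stft g u) 2 volume)) := by
    have := ENNReal.tendsto_ofReal ((tendsto_iff_norm_sub_tendsto_zero.1 hv).const_mul g.l2norm)
    simpa using tendsto_const_nhds.add this
  refine le_of_tendsto_of_tendsto' (ENNReal.tendsto_ofReal (hv.norm.const_mul _)) h1 fun k => ?_
  rw [← eLpNorm_stft_toL2]
  have h2 : stft g (toL2 n m (v k)) = stft g u + stft g (toL2 n m (v k) - u) := by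
    rw [stft_sub]; abel
  rw [h2]
  exact (eLpNorm_add_le (aestronglyMeasurable_stft g _) (aestronglyMeasurable_stft g _)
    (by norm_num)).trans (add_le_add le_rfl (hle _))

/-! ### Distributional solutions -/

/-- `Q v = f` in the sense of distributions, for `Q = ∑ₖ Aₖ ∂ₖ + ∑ₖ xₖ Bₖ` and `v, f ∈ L²`: the
formal adjoint `-∑ₖ Aₖᴴ ∂ₖ + ∑ₖ xₖ Bₖᴴ` is moved to the test function. -/
def WeakEq (A B : Fin n → Matrix (Fin m) (Fin m) ℂ) (v f : L2 n m) : Prop :=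
  ∀ φ : testFunctions n m,
    inner ℂ (toL2 n m (opTest (fun k => -(A k)ᴴ) (fun k => (B k)ᴴ) φ)) v = inner ℂ (toL2 n m φ) f

theorem mat_conjTranspose (M : Matrix (Fin m) (Fin m) ℂ) :
    mat Mᴴ = ContinuousLinearMap.adjoint (mat M) := by
  rw [← ContinuousLinearMap.star_eq_adjoint, ← Matrix.star_eq_conjTranspose]
  exact map_star (Matrix.toEuclideanCLM (𝕜 := ℂ)) M

theorem inner_mat_conjTranspose (M : Matrix (Fin m) (Fin m) ℂ) (v w : Cm m) :
    inner ℂ (mat Mᴴ v) w = inner ℂ v (mat M w) := by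
  rw [mat_conjTranspose, ContinuousLinearMap.adjoint_inner_left]

theorem inner_sym_adjoint (A B : Fin n → Matrix (Fin m) (Fin m) ℂ) (z : Rn n × Rn n)
    (v w : Cm m) :
    inner ℂ (sym (fun k => -(A k)ᴴ) (fun k => (B k)ᴴ) z v) w = inner ℂ v (sym A B z w) := by
  simp only [sym, add_apply, sum_apply, smul_apply, inner_add_left, inner_add_right, sum_inner,
    inner_sum, inner_smul_left, inner_smul_right, inner_mat_conjTranspose, map_neg, neg_apply,
    inner_neg_left, map_mul, Complex.conj_ofReal, Complex.conj_I, map_ofNat]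
  congr 1
  refine Finset.sum_congr rfl fun k _ => ?_
  ring

/-- The terms of `V_g (Q v)` in which a derivative or a coordinate falls on the window. -/
def windowError (A B : Fin n → Matrix (Fin m) (Fin m) ℂ) (g : Window n) (v : L2 n m)
    (z : Rn n × Rn n) : Cm m :=
  -∑ k, mat (A k) (stft (g.deriv k) v z) + ∑ k, mat (B k) (stft (g.mul k) v z)

/-- The windowed Fourier transform turns `Q` into multiplication by its symbol, up to terms that
are bounded by the `L²` norm. -/
theorem WeakEq.stft_eq {A B : Fin n → Matrix (Fin m) (Fin m) ℂ} {v f : L2 n m}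
    (h : WeakEq A B v f) (g : Window n) (z : Rn n × Rn n) :
    stft g f z = sym A B z (stft g v z) + windowError A B g v z := by
  refine ext_inner_left ℂ fun e => ?_
  rw [inner_stft, ← h, opTest_packet]
  simp only [map_add, map_sum, inner_add_left, inner_add_right, sum_inner, windowError,
    inner_sum, inner_neg_right, ← inner_stft, inner_sym_adjoint, inner_mat_conjTranspose, map_neg,
    neg_apply, inner_neg_left, Finset.sum_neg_distrib]

theorem aestronglyMeasurable_mat_stft (M : Matrix (Fin m) (Fin m) ℂ) (g : Window n) (v : L2 n m) :
    AEStronglyMeasurable (fun z => mat M (stft g v z)) volume :=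
  ((mat M).continuous.comp (continuous_stft g v)).aestronglyMeasurable

theorem continuous_windowError (A B : Fin n → Matrix (Fin m) (Fin m) ℂ) (g : Window n)
    (v : L2 n m) : Continuous (windowError A B g v) := by
  unfold windowError
  have := fun h : Window n => continuous_stft h v
  fun_prop

theorem eLpNorm_mat_stft_le (M : Matrix (Fin m) (Fin m) ℂ) (g : Window n) (v : L2 n m) :
    eLpNorm (fun z => mat M (stft g v z)) 2 volume ≤ ENNReal.ofReal (‖mat M‖ * g.l2norm * ‖v‖) := by
  rw [mul_assoc, ENNReal.ofReal_mul (norm_nonneg _), ← eLpNorm_stft]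
  exact eLpNorm_le_mul_eLpNorm_of_ae_le_mul (ae_of_all _ fun z => (mat M).le_opNorm _) 2

/-- A bound for the `L²` operator norm of `windowError A B g`. -/
def windowErrorBound (A B : Fin n → Matrix (Fin m) (Fin m) ℂ) (g : Window n) : ℝ :=
  ∑ k, ‖mat (A k)‖ * (g.deriv k).l2norm + ∑ k, ‖mat (B k)‖ * (g.mul k).l2norm

theorem windowErrorBound_nonneg (A B : Fin n → Matrix (Fin m) (Fin m) ℂ) (g : Window n) :
    0 ≤ windowErrorBound A B g :=
  add_nonneg (Finset.sum_nonneg fun _ _ => mul_nonneg (norm_nonneg _) (Window.l2norm_nonneg _))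
    (Finset.sum_nonneg fun _ _ => mul_nonneg (norm_nonneg _) (Window.l2norm_nonneg _))

theorem eLpNorm_windowError_le (A B : Fin n → Matrix (Fin m) (Fin m) ℂ) (g : Window n)
    (v : L2 n m) :
    eLpNorm (windowError A B g v) 2 volume ≤ ENNReal.ofReal (windowErrorBound A B g * ‖v‖) := by
  have key : ∀ (M : Fin n → Matrix (Fin m) (Fin m) ℂ) (h : Fin n → Window n),
      eLpNorm (∑ k, fun z => mat (M k) (stft (h k) v z)) 2 volume ≤
        ENNReal.ofReal (∑ k, ‖mat (M k)‖ * (h k).l2norm * ‖v‖) := by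
    intro M h
    rw [ENNReal.ofReal_sum_of_nonneg fun k _ => mul_nonneg
      (mul_nonneg (norm_nonneg _) (Window.l2norm_nonneg _)) (norm_nonneg _)]
    exact (eLpNorm_sum_le (fun k _ => aestronglyMeasurable_mat_stft _ _ _) (by norm_num)).trans
      (Finset.sum_le_sum fun k _ => eLpNorm_mat_stft_le _ _ _)
  have e : windowError A B g v = -(∑ k, fun z => mat (A k) (stft (g.deriv k) v z)) +
      ∑ k, fun z => mat (B k) (stft (g.mul k) v z) := by
    funext z; simp [windowError]
  rw [e, windowErrorBound, add_mul, Finset.sum_mul, Finset.sum_mul, ENNReal.ofReal_add]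
  · refine (eLpNorm_add_le ?_ ?_ (by norm_num)).trans (add_le_add ?_ (key _ _))
    · exact (Finset.aestronglyMeasurable_sum _ fun k _ => aestronglyMeasurable_mat_stft _ _ _).neg
    · exact Finset.aestronglyMeasurable_sum _ fun k _ => aestronglyMeasurable_mat_stft _ _ _
    · rw [eLpNorm_neg]
      exact key _ _
  all_goals
    exact Finset.sum_nonneg fun k _ =>
      mul_nonneg (mul_nonneg (norm_nonneg _) (Window.l2norm_nonneg _)) (norm_nonneg _)

theorem inner_toL2_mulMat (M : Matrix (Fin m) (Fin m) ℂ) (φ u : testFunctions n m) :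
    inner ℂ (toL2 n m (mulMat Mᴴ φ)) (toL2 n m u) =
      inner ℂ (toL2 n m φ) (toL2 n m (mulMat M u)) := by
  rw [inner_toL2_toL2, inner_toL2_toL2]
  exact integral_congr_ae (ae_of_all _ fun x => inner_mat_conjTranspose M _ _)

theorem inner_toL2_mulCoord (k : Fin n) (φ u : testFunctions n m) :
    inner ℂ (toL2 n m (mulCoord k φ)) (toL2 n m u) =
      inner ℂ (toL2 n m φ) (toL2 n m (mulCoord k u)) := by
  rw [inner_toL2_toL2, inner_toL2_toL2]
  refine integral_congr_ae (ae_of_all _ fun x => ?_)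
  simp only [mulCoord, LinearMap.coe_mk, AddHom.coe_mk]
  rw [← Complex.coe_smul, ← Complex.coe_smul, inner_smul_left, inner_smul_right,
    Complex.conj_ofReal]

theorem inner_toL2_partialD (k : Fin n) (φ u : testFunctions n m) :
    inner ℂ (toL2 n m (partialD k φ)) (toL2 n m u) =
      -inner ℂ (toL2 n m φ) (toL2 n m (partialD k u)) := by
  rw [inner_toL2_toL2, inner_toL2_toL2]
  have hd : ∀ w : testFunctions n m, Differentiable ℝ (w : Rn n → Cm m) :=
    fun w => w.2.1.differentiable (by simp)
  have hi : ∀ w w' : testFunctions n m,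
      Integrable (fun x => inner ℂ ((w : Rn n → Cm m) x) ((w' : Rn n → Cm m) x)) volume := by
    intro w w'
    refine (w.2.1.continuous.inner w'.2.1.continuous).integrable_of_hasCompactSupport ?_
    exact w.2.2.mono fun x hx h0 => hx (by simp [h0])
  have h := integral_bilinear_hasFDerivAt_right_eq_neg_left_of_integrable
    (μ := (volume : Measure (Rn n))) (f := (φ : Rn n → Cm m)) (g := (u : Rn n → Cm m))
    (B := (isBoundedBilinearMap_inner (𝕜 := ℂ) (E := Cm m)).toContinuousLinearMap)
    (v := EuclideanSpace.single k 1)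
    (hi (partialD k φ) u) (hi φ (partialD k u)) (hi φ u)
    (fun x _ => (hd φ x).hasFDerivAt) (fun x _ => (hd u x).hasFDerivAt)
  exact (neg_eq_iff_eq_neg.2 h).symm

theorem partialD_mulMat (k : Fin n) (M : Matrix (Fin m) (Fin m) ℂ) (u : testFunctions n m) :
    partialD k (mulMat M u) = mulMat M (partialD k u) := by
  ext1; funext x
  have hu : DifferentiableAt ℝ (u : Rn n → Cm m) x :=
    (u.2.1.differentiable (by simp)).differentiableAt
  have h := (((mat M).restrictScalars ℝ).hasFDerivAt.comp x hu.hasFDerivAt).fderiv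
  exact congrArg (fun L => L (EuclideanSpace.single k 1)) h

theorem mulCoord_mulMat (k : Fin n) (M : Matrix (Fin m) (Fin m) ℂ) (u : testFunctions n m) :
    mulCoord k (mulMat M u) = mulMat M (mulCoord k u) := by
  ext1; funext x
  simp only [mulCoord, mulMat, LinearMap.coe_mk, AddHom.coe_mk]
  rw [← Complex.coe_smul, ← Complex.coe_smul, map_smul]

theorem mulMat_neg (M : Matrix (Fin m) (Fin m) ℂ) (u : testFunctions n m) :
    mulMat (-M) u = -mulMat M u := by
  ext1; funext x
  simp [mulMat]

theorem weakEq_toL2 (A B : Fin n → Matrix (Fin m) (Fin m) ℂ) (u : testFunctions n m) :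
    WeakEq A B (toL2 n m u) (toL2 n m (opTest A B u)) := by
  intro φ
  simp only [opTest, LinearMap.add_apply, LinearMap.sum_apply, LinearMap.comp_apply, map_add,
    map_sum, inner_add_left, inner_add_right, sum_inner, inner_sum, mulMat_neg, map_neg,
    inner_neg_left, inner_toL2_mulMat, inner_toL2_mulCoord, inner_toL2_partialD,
    partialD_mulMat, mulCoord_mulMat, neg_neg]

theorem isClosed_weakEq (A B : Fin n → Matrix (Fin m) (Fin m) ℂ) :
    IsClosed {y : L2 n m × L2 n m | WeakEq A B y.1 y.2} := by
  simp only [WeakEq, Set.ofPred_forall]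
  exact isClosed_iInter fun φ => isClosed_eq (continuous_const.inner continuous_fst)
    (continuous_const.inner continuous_snd)

theorem WeakEq.unique {A B : Fin n → Matrix (Fin m) (Fin m) ℂ} {v f f' : L2 n m}
    (h : WeakEq A B v f) (h' : WeakEq A B v f') : f = f' :=
  (denseRange_toL2 n m).eq_of_inner_right ℂ fun φ => (h φ).symm.trans (h' φ)

/-! ### Estimates in phase space -/

/-- The symbol is injective away from the origin of phase space; this is ellipticity in the isotropic
calculus, in which `x` and `ξ` have the same weight. -/
def IsotropicElliptic (A B : Fin n → Matrix (Fin m) (Fin m) ℂ) : Prop :=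
  ∀ z : Rn n × Rn n, z ≠ 0 → ∀ v, sym A B z v = 0 → v = 0

theorem sym_smul (A B : Fin n → Matrix (Fin m) (Fin m) ℂ) (t : ℝ) (z : Rn n × Rn n) :
    sym A B (t • z) = (t : ℂ) • sym A B z := by
  simp only [sym, smul_add, Finset.smul_sum, smul_smul]
  congr 1 <;> refine Finset.sum_congr rfl fun k _ => ?_ <;> congr 1 <;> simp
  ring

theorem continuous_sym (A B : Fin n → Matrix (Fin m) (Fin m) ℂ) : Continuous (sym A B) := by
  unfold sym
  fun_prop

theorem IsotropicElliptic.exists_lower_bound {A B : Fin n → Matrix (Fin m) (Fin m) ℂ}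
    (h : IsotropicElliptic A B) :
    ∃ c : ℝ, 0 < c ∧ ∀ z v, c * (‖z‖ * ‖v‖) ≤ ‖sym A B z v‖ := by
  have hK : IsCompact (Metric.sphere (0 : Rn n × Rn n) 1 ×ˢ Metric.sphere (0 : Cm m) 1) :=
    (isCompact_sphere _ _).prod (isCompact_sphere _ _)
  have hf : Continuous fun y : (Rn n × Rn n) × Cm m => ‖sym A B y.1 y.2‖ :=
    (((continuous_sym A B).comp continuous_fst).clm_apply continuous_snd).norm
  obtain ⟨c, hc, hcK⟩ := hK.exists_forall_le' hf.continuousOn (a := 0) (by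
    rintro ⟨z, v⟩ ⟨hz, hv⟩
    rw [mem_sphere_zero_iff_norm] at hz hv
    refine norm_pos_iff.2 fun h0 => ?_
    rw [h z (by rintro rfl; simp at hz) v h0] at hv
    simp at hv)
  refine ⟨c, hc, fun z v => ?_⟩
  rcases eq_or_ne z 0 with rfl | hz
  · simp
  rcases eq_or_ne v 0 with rfl | hv
  · simp
  have h1 := hcK (‖z‖⁻¹ • z, ((‖v‖⁻¹ : ℝ) : ℂ) • v) (by
    constructor <;> rw [mem_sphere_zero_iff_norm] <;> simp [norm_smul, hz, hv])
  have h2 : 0 < ‖z‖ := norm_pos_iff.2 hz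
  have h3 : 0 < ‖v‖ := norm_pos_iff.2 hv
  simp only [sym_smul, smul_apply, map_smul, norm_smul, Complex.norm_real, norm_inv,
    norm_norm] at h1
  rw [← mul_assoc, ← mul_inv, ← div_eq_inv_mul, le_div_iff₀ (by positivity)] at h1
  rwa [mul_comm ‖z‖]

theorem exists_sym_upper_bound (A B : Fin n → Matrix (Fin m) (Fin m) ℂ) :
    ∃ C : ℝ, 0 ≤ C ∧ ∀ z v, ‖sym A B z v‖ ≤ C * (‖z‖ * ‖v‖) := by
  refine ⟨∑ k, 2 * Real.pi * ‖mat (A k)‖ + ∑ k, ‖mat (B k)‖, by positivity, fun z v => ?_⟩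
  rw [← mul_assoc]
  refine (ContinuousLinearMap.le_opNorm _ _).trans ?_
  gcongr
  rw [sym, add_mul, Finset.sum_mul, Finset.sum_mul]
  refine (norm_add_le _ _).trans (add_le_add ?_ ?_) <;>
    refine (norm_sum_le _ _).trans (Finset.sum_le_sum fun k _ => ?_)
  · have h1 : |z.2 k| ≤ ‖z‖ := (PiLp.norm_apply_le z.2 k).trans (norm_snd_le z)
    have h2 := mul_le_mul_of_nonneg_left h1 (by positivity : 0 ≤ 2 * Real.pi * ‖mat (A k)‖)
    rw [norm_smul]
    simp [abs_of_pos Real.pi_pos]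
    linarith
  · have h1 : |z.1 k| ≤ ‖z‖ := (PiLp.norm_apply_le z.1 k).trans (norm_fst_le z)
    have h2 := mul_le_mul_of_nonneg_left h1 (norm_nonneg (mat (B k)))
    rw [norm_smul]
    simp
    linarith

/-- The `L²` norm of `|z| V_g v(z)`, equivalent modulo `‖v‖` to the harmonic oscillator norm. -/
def oscSTFT (g : Window n) (v : L2 n m) : ENNReal :=
  eLpNorm (fun z => ‖z‖ • stft g v z) 2 volume

/-- The isotropic elliptic estimate. -/
theorem IsotropicElliptic.exists_oscSTFT_le {A B : Fin n → Matrix (Fin m) (Fin m) ℂ}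
    (h : IsotropicElliptic A B) (g : Window n) :
    ∃ C : ℝ, 0 ≤ C ∧ ∀ v f : L2 n m, WeakEq A B v f →
      oscSTFT g v ≤ ENNReal.ofReal (C * (‖f‖ + ‖v‖)) := by
  obtain ⟨c, hc, hcb⟩ := h.exists_lower_bound
  have hE := windowErrorBound_nonneg A B g
  have hg := g.l2norm_nonneg
  refine ⟨c⁻¹ * (g.l2norm + windowErrorBound A B g), by positivity, fun v f hvf => ?_⟩
  -- `sym A B z (stft g v z)` is `stft g f - windowError`
  have h1 : oscSTFT g v ≤ ENNReal.ofReal c⁻¹ *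
      eLpNorm (stft g f - windowError A B g v) 2 volume := by
    refine eLpNorm_le_mul_eLpNorm_of_ae_le_mul (ae_of_all _ fun z => ?_) 2
    rw [Pi.sub_apply, hvf.stft_eq, add_sub_cancel_right, norm_smul, norm_norm,
      ← div_eq_inv_mul, le_div_iff₀ hc, mul_comm]
    exact hcb _ _
  have h2 : eLpNorm (stft g f - windowError A B g v) 2 volume ≤
      ENNReal.ofReal (g.l2norm * ‖f‖ + windowErrorBound A B g * ‖v‖) := by
    rw [ENNReal.ofReal_add (by positivity) (by positivity), ← eLpNorm_stft]
    exact (eLpNorm_sub_le (aestronglyMeasurable_stft g f)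
      (continuous_windowError A B g v).aestronglyMeasurable (by norm_num)).trans
      (add_le_add le_rfl (eLpNorm_windowError_le A B g v))
  refine h1.trans ((mul_le_mul_right h2 _).trans ?_)
  rw [← ENNReal.ofReal_mul (by positivity), mul_assoc]
  refine ENNReal.ofReal_le_ofReal ?_
  gcongr
  nlinarith [norm_nonneg f, norm_nonneg v, mul_nonneg hg (norm_nonneg v),
    mul_nonneg hE (norm_nonneg f)]

/-- Conversely `Q v` is controlled by `|z| V_g v` and `v`. -/
theorem WeakEq.exists_norm_le (A B : Fin n → Matrix (Fin m) (Fin m) ℂ) {g : Window n}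
    (hg : 0 < g.l2norm) :
    ∃ C : ℝ, 0 ≤ C ∧ ∀ (v f : L2 n m) (M : ℝ), 0 ≤ M → WeakEq A B v f →
      oscSTFT g v ≤ ENNReal.ofReal M → ‖f‖ ≤ C * (M + ‖v‖) := by
  obtain ⟨C, hC, hCb⟩ := exists_sym_upper_bound A B
  have hE := windowErrorBound_nonneg A B g
  refine ⟨g.l2norm⁻¹ * (C + windowErrorBound A B g), by positivity, fun v f M hM hvf hosc => ?_⟩
  have h1 : eLpNorm (fun z => sym A B z (stft g v z)) 2 volume ≤ ENNReal.ofReal (C * M) := by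
    rw [ENNReal.ofReal_mul hC]
    refine le_trans ?_ (mul_le_mul_right hosc _)
    refine eLpNorm_le_mul_eLpNorm_of_ae_le_mul (ae_of_all _ fun z => ?_) 2
    rw [norm_smul, norm_norm]
    exact hCb _ _
  have h2 : stft g f = (fun z => sym A B z (stft g v z)) + windowError A B g v := by
    funext z
    exact hvf.stft_eq g z
  have h3 : ENNReal.ofReal (g.l2norm * ‖f‖) ≤
      ENNReal.ofReal (C * M + windowErrorBound A B g * ‖v‖) := by
    rw [ENNReal.ofReal_add (by positivity) (by positivity), ← eLpNorm_stft, h2]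
    exact (eLpNorm_add_le ((continuous_sym A B).clm_apply
      (continuous_stft g v)).aestronglyMeasurable
      (continuous_windowError A B g v).aestronglyMeasurable (by norm_num)).trans
      (add_le_add h1 (eLpNorm_windowError_le A B g v))
  rw [ENNReal.ofReal_le_ofReal_iff (by positivity)] at h3
  rw [mul_assoc, ← div_eq_inv_mul, le_div_iff₀ hg, mul_comm]
  nlinarith [norm_nonneg v, mul_nonneg hC (norm_nonneg v), mul_nonneg hE hM]

/-- A form of Rellich's theorem: on a subspace of finite codimension, the `L²` norm is a small
multiple of the harmonic oscillator norm. The subspace is cut out by finitely many wave packets,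
which form a net for the packets centred in a large ball of phase space. -/
theorem exists_cofg_norm_le {g : Window n} (hg : 0 < g.l2norm) {δ : ℝ} (hδ : 0 < δ) :
    ∃ F : Submodule ℂ (L2 n m), IsClosed (F : Set (L2 n m)) ∧ F.CoFG ∧
      ∀ v ∈ F, ∀ M : ℝ, 0 ≤ M → oscSTFT g v ≤ ENNReal.ofReal M → ‖v‖ ≤ δ * (M + ‖v‖) := by
  -- Outside the ball of radius `R`, `‖stft g v z‖ ≤ R⁻¹ ‖z‖ ‖stft g v z‖`; inside, it is at most
  -- `ε ‖v‖` for `v` orthogonal to an `ε`-net of packets.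
  set R : ℝ := (g.l2norm * δ)⁻¹ with hR
  have hRpos : 0 < R := by positivity
  set b : Set (Rn n × Rn n) := Metric.closedBall 0 R with hb
  have hbc : IsCompact b := isCompact_closedBall _ _
  set W : ℝ := (volume b).toReal ^ (1 / 2 : ℝ) with hW
  have hW0 : 0 ≤ W := by positivity
  set ε : ℝ := g.l2norm * δ / (W + 1) with hε
  have hεpos : 0 < ε := by positivity
  have hεW : W * ε ≤ g.l2norm * δ := by
    rw [hε, mul_div_assoc', div_le_iff₀ (by positivity)]
    nlinarith [mul_pos hg hδ]
  obtain ⟨t, htf, ht⟩ := Metric.totallyBounded_iff.1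
    (hbc.image (continuous_adjoint_packetL (m := m) g)).totallyBounded ε hεpos
  have : Fintype t := htf.fintype
  let T : L2 n m →L[ℂ] (t → Cm m) := ContinuousLinearMap.pi fun j => j.1
  refine ⟨LinearMap.ker T.toLinearMap, T.isClosed_ker, Submodule.CoFG.ker _,
    fun v hv M hM hosc => ?_⟩
  have hin : ∀ z ∈ b, ‖stft g v z‖ ≤ ε * ‖v‖ := by
    intro z hz
    obtain ⟨j, hj, hjz⟩ := Set.mem_iUnion₂.1 (ht ⟨z, hz, rfl⟩)
    have h0 : j v = 0 := congrFun hv ⟨j, hj⟩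
    have h1 : stft g v z =
        (ContinuousLinearMap.adjoint (packetL g z) - j : L2 n m →L[ℂ] Cm m) v := by
      rw [sub_apply, h0, sub_zero]; rfl
    rw [h1]
    refine (ContinuousLinearMap.le_opNorm _ _).trans ?_
    gcongr
    exact (mem_ball_iff_norm.1 hjz).le
  have hpt : ∀ z, ‖stft g v z‖ ≤
      ‖b.indicator (fun _ => ε * ‖v‖) z + R⁻¹ * (‖z‖ * ‖stft g v z‖)‖ := by
    intro z
    have hnn : 0 ≤ R⁻¹ * (‖z‖ * ‖stft g v z‖) := by positivity
    refine le_trans ?_ (le_abs_self _)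
    by_cases hz : z ∈ b
    · rw [Set.indicator_of_mem hz]
      linarith [hin z hz]
    · rw [Set.indicator_of_notMem hz, zero_add]
      have hz' : R ≤ ‖z‖ := by
        rw [hb, mem_closedBall_zero_iff, not_le] at hz
        exact hz.le
      rw [← div_eq_inv_mul, le_div_iff₀ hRpos, mul_comm]
      gcongr
  have h1 : eLpNorm (b.indicator fun _ => ε * ‖v‖) 2 volume ≤ ENNReal.ofReal (W * (ε * ‖v‖)) := by
    rw [eLpNorm_indicator_const hbc.measurableSet (by norm_num) (by norm_num), mul_comm,
      ENNReal.ofReal_mul hW0, Real.enorm_eq_ofReal (by positivity)]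
    gcongr
    rw [hW, ← ENNReal.ofReal_rpow_of_nonneg (by positivity) (by positivity),
      ENNReal.ofReal_toReal hbc.measure_lt_top.ne]
    simp
  have h2 : eLpNorm (fun z => R⁻¹ * (‖z‖ * ‖stft g v z‖)) 2 volume ≤ ENNReal.ofReal (R⁻¹ * M) := by
    rw [ENNReal.ofReal_mul (by positivity)]
    refine le_trans ?_ (mul_le_mul_right hosc _)
    refine eLpNorm_le_mul_eLpNorm_of_ae_le_mul (ae_of_all _ fun z => ?_) 2
    rw [norm_smul, norm_norm, norm_mul, norm_mul, norm_norm, norm_norm,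
      Real.norm_of_nonneg (by positivity)]
  have h3 : ENNReal.ofReal (g.l2norm * ‖v‖) ≤ ENNReal.ofReal (W * (ε * ‖v‖) + R⁻¹ * M) := by
    rw [← eLpNorm_stft, ENNReal.ofReal_add (by positivity) (by positivity)]
    refine (eLpNorm_mono hpt).trans ((eLpNorm_add_le ?_ ?_ (by norm_num)).trans (add_le_add h1 h2))
    · exact (aestronglyMeasurable_const).indicator hbc.measurableSet
    · exact (continuous_const.mul
        (continuous_norm.mul (continuous_stft g v).norm)).aestronglyMeasurable
  rw [ENNReal.ofReal_le_ofReal_iff (by positivity), hR, inv_inv] at h3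
  have h4 : W * (ε * ‖v‖) ≤ g.l2norm * δ * ‖v‖ := by
    rw [← mul_assoc]
    gcongr
  refine le_of_mul_le_mul_left ?_ hg
  linarith

/-- An elliptic operator is bounded below, in the sense of distributions, on a closed subspace of
finite codimension of `L²`. -/
theorem IsotropicElliptic.exists_cofg_bound {A B : Fin n → Matrix (Fin m) (Fin m) ℂ}
    (h : IsotropicElliptic A B) :
    ∃ F : Submodule ℂ (L2 n m), IsClosed (F : Set (L2 n m)) ∧ F.CoFG ∧
      ∃ C : ℝ, 0 ≤ C ∧ ∀ v ∈ F, ∀ f, WeakEq A B v f → ‖v‖ ≤ C * ‖f‖ := by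
  obtain ⟨g, hg⟩ := Window.exists_l2norm_pos n
  obtain ⟨C, hC, hCb⟩ := h.exists_oscSTFT_le g
  -- `δ` is chosen so that `δ (C ‖v‖ + ‖v‖)` is half of `‖v‖` and can be absorbed.
  obtain ⟨F, hF, hF', hFb⟩ := exists_cofg_norm_le (m := m) hg (δ := (2 * (C + 1))⁻¹) (by positivity)
  refine ⟨F, hF, hF', 1, zero_le_one, fun v hv f hvf => ?_⟩
  have h1 := hFb v hv (C * (‖f‖ + ‖v‖)) (by positivity) (hCb v f hvf)
  rw [← div_eq_inv_mul, le_div_iff₀ (by positivity)] at h1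
  nlinarith [norm_nonneg f, norm_nonneg v, mul_nonneg hC (norm_nonneg v)]

/-! ### Fredholm operators between Hilbert spaces -/

section Abstract

/-- The index `dim ker S - dim coker S` of a linear map, meaningful when both dimensions are finite,
since `finrank` is zero on infinite-dimensional spaces. -/
def linIndex {X Y : Type*} [AddCommGroup X] [Module ℂ X] [AddCommGroup Y] [Module ℂ Y]
    (S : X →ₗ[ℂ] Y) : ℤ :=
  (Module.finrank ℂ (LinearMap.ker S) : ℤ) - (Module.finrank ℂ (Y ⧸ LinearMap.range S) : ℤ)

/-- If `S` is injective on a complement `X₁` of a finite-dimensional space `N`, and `F` is a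
finite-dimensional complement of `S X₁`, then the kernel and cokernel of `S` are those of the map
`N → F` that `S` induces modulo `S X₁`. -/
theorem linIndex_eq_of_isCompl {X Y : Type*} [AddCommGroup X] [Module ℂ X] [AddCommGroup Y]
    [Module ℂ Y] (S : X →ₗ[ℂ] Y) {X₁ N : Submodule ℂ X} {F : Submodule ℂ Y}
    [FiniteDimensional ℂ N] [FiniteDimensional ℂ F] (hX : IsCompl X₁ N)
    (hinj : ∀ x ∈ X₁, S x = 0 → x = 0) (hY : IsCompl (X₁.map S) F) :
    linIndex S = (Module.finrank ℂ N : ℤ) - (Module.finrank ℂ F : ℤ) := by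
  let p : Y →ₗ[ℂ] F := F.projectionOnto _ hY.symm
  let π : X →ₗ[ℂ] N := N.projectionOnto _ hX.symm
  have hp : ∀ y, p y = 0 ↔ y ∈ X₁.map S := fun y =>
    Submodule.projectionOnto_apply_eq_zero_iff hY.symm
  have hπ : ∀ x, π x = 0 ↔ x ∈ X₁ := fun x => Submodule.projectionOnto_apply_eq_zero_iff hX.symm
  have hπN : ∀ x : N, π x = x := fun x => Submodule.projectionOnto_apply_left hX.symm x
  have hpS : ∀ x, p (S x) = p (S (π x)) := by
    intro x
    rw [← sub_eq_zero, ← map_sub, ← map_sub, hp]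
    refine ⟨_, (hπ _).1 ?_, rfl⟩
    rw [map_sub, hπN, sub_self]
  let φ : N →ₗ[ℂ] F := p ∘ₗ S ∘ₗ N.subtype
  have hφ : ∀ x, φ (π x) = p (S x) := fun x => (hpS x).symm
  have hker : Module.finrank ℂ (LinearMap.ker S) = Module.finrank ℂ (LinearMap.ker φ) := by
    have h1 : Function.Injective (π.domRestrict (LinearMap.ker S)) := by
      refine (injective_iff_map_eq_zero _).2 fun x hx => ?_
      exact Subtype.ext (hinj x ((hπ _).1 hx) x.2)
    have h2 : LinearMap.range (π.domRestrict (LinearMap.ker S)) = LinearMap.ker φ := by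
      ext x
      constructor
      · rintro ⟨y, rfl⟩
        change φ (π y) = 0
        rw [hφ, show S y = 0 from y.2, map_zero]
      · intro hx
        obtain ⟨x₁, hx₁, h⟩ := (hp _).1 hx
        refine ⟨⟨x - x₁, ?_⟩, ?_⟩
        · rw [LinearMap.mem_ker, map_sub, h]
          exact sub_self _
        · change π (x - x₁) = x
          rw [map_sub, hπN, (hπ _).2 hx₁, sub_zero]
    rw [← h2, LinearMap.finrank_range_of_inj h1]
  have hcoker : Module.finrank ℂ (Y ⧸ LinearMap.range S) =
      Module.finrank ℂ (F ⧸ LinearMap.range φ) := by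
    let q : Y →ₗ[ℂ] F ⧸ LinearMap.range φ := (LinearMap.range φ).mkQ ∘ₗ p
    have hq : Function.Surjective q :=
      (Submodule.mkQ_surjective _).comp (Submodule.projectionOnto_surjective hY.symm)
    have h1 : LinearMap.ker q = LinearMap.range S := by
      ext y
      rw [LinearMap.mem_ker, LinearMap.comp_apply, Submodule.mkQ_apply,
        Submodule.Quotient.mk_eq_zero]
      constructor
      · rintro ⟨x, hx⟩
        have h2 : y - S x ∈ X₁.map S := by
          rw [← hp, map_sub, ← hx]
          exact sub_self _
        obtain ⟨x₁, -, h3⟩ := h2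
        exact ⟨x₁ + x, by rw [map_add, h3, sub_add_cancel]⟩
      · rintro ⟨x, rfl⟩
        exact ⟨π x, hφ x⟩
    exact ((Submodule.quotEquivOfEq _ _ h1.symm).trans
      (q.quotKerEquivOfSurjective hq)).finrank_eq
  have h1 := LinearMap.finrank_range_add_finrank_ker φ
  have h2 := Submodule.finrank_quotient_add_finrank (LinearMap.range φ)
  rw [linIndex, hker, hcoker]
  omega

variable {X Y : Type*} [NormedAddCommGroup X] [InnerProductSpace ℂ X] [CompleteSpace X]
  [NormedAddCommGroup Y] [InnerProductSpace ℂ Y] [CompleteSpace Y]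

/-- An operator that is bounded below on a closed subspace of finite codimension, and whose range
has a finite-dimensional orthogonal complement, is Fredholm. -/
theorem isFredholm_of_bounded_below (S : X →L[ℂ] Y) {E : Submodule ℂ X}
    (hE : IsClosed (E : Set X)) (hE' : E.CoFG) {C : ℝ} (hC : 0 ≤ C)
    (hS : ∀ w ∈ E, ‖w‖ ≤ C * ‖S w‖)
    (hF : FiniteDimensional ℂ (LinearMap.range S.toLinearMap)ᗮ) : S.IsFredholm := by
  have hanti : AntilipschitzWith C.toNNReal (S.domRestrict E) := by
    refine ContinuousLinearMap.antilipschitz_of_bound _ fun w => ?_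
    rw [Real.coe_toNNReal _ hC]
    exact hS w w.2
  have hEc : CompleteSpace E := hE.completeSpace_coe
  have hemb := hanti.isClosedEmbedding (S.domRestrict E).uniformContinuous
  have h := (S.isStrictMap_isClosed_range_iff_restrict E hE).2
    ⟨hemb.isEmbedding.isStrictMap, hemb.isClosed_range⟩
  have hker : FiniteDimensional ℂ S.ker := by
    rw [← Submodule.fg_iff_finiteDimensional]
    refine hE'.fg_of_disjoint (Submodule.disjoint_def.2 fun x hx' hx => ?_)
    have h1 := hS x hx
    rw [show S x = 0 from hx', norm_zero, mul_zero] at h1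
    exact norm_le_zero_iff.1 h1
  have hcl : CompleteSpace S.range := h.2.completeSpace_coe
  refine ⟨h.1, h.2, hker, ?_, Submodule.ClosedComplemented.of_finiteDimensional _⟩
  exact Submodule.FG.cofg_of_isCompl (Submodule.isCompl_orthogonal _).symm
    (Submodule.fg_iff_finiteDimensional _ |>.2 hF)

/-- The index is locally constant: for `S` near `S₀`, the map `(x, f) ↦ S x + f` from
`(ker S₀)ᗮ × (range S₀)ᗮ` stays invertible. -/
theorem eventually_linIndex_eq {S₀ : X →L[ℂ] Y} (h : S₀.IsFredholm) :
    ∀ᶠ S : X →L[ℂ] Y in 𝓝 S₀, linIndex S.toLinearMap = linIndex S₀.toLinearMap := by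
  have hker := h.finite_ker
  have hcl : CompleteSpace S₀.range := h.isClosed_range.completeSpace_coe
  have hYc : IsCompl S₀.range S₀.rangeᗮ := Submodule.isCompl_orthogonal _
  have hXc : IsCompl S₀.kerᗮ S₀.ker :=
    (Submodule.isCompl_orthogonal _).symm
  have hF : FiniteDimensional ℂ S₀.rangeᗮ :=
    (Submodule.fg_iff_finiteDimensional _).1 (h.finite_coker.fg_of_isCompl hYc)
  let Ψ : (X →L[ℂ] Y) → (S₀.kerᗮ × S₀.rangeᗮ →L[ℂ] Y) := fun S =>
    (S ∘L S₀.kerᗮ.subtypeL).coprod S₀.rangeᗮ.subtypeL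
  have hΨ : Continuous Ψ := by
    have h1 : Ψ = fun S => (S ∘L S₀.kerᗮ.subtypeL) ∘L ContinuousLinearMap.fst ℂ _ _ +
        S₀.rangeᗮ.subtypeL ∘L ContinuousLinearMap.snd ℂ _ _ := by
      funext S; ext <;> simp [Ψ]
    rw [h1]
    fun_prop
  have hΨa : ∀ S x f, Ψ S (x, f) = S x + f := fun S x f => by simp [Ψ]
  have hbij : Function.Bijective (Ψ S₀) := by
    constructor
    · refine (injective_iff_map_eq_zero _).2 ?_
      rintro ⟨x, f⟩ hxf
      rw [hΨa] at hxf
      have h1 : (f : Y) = 0 := Submodule.disjoint_def.1 hYc.disjoint _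
        ((eq_neg_of_add_eq_zero_right hxf).symm ▸ neg_mem ⟨x, rfl⟩) f.2
      rw [h1, add_zero] at hxf
      have h2 : (x : X) = 0 := Submodule.disjoint_def.1 hXc.disjoint _ x.2 hxf
      exact Prod.ext (Subtype.ext h2) (Subtype.ext h1)
    · intro y
      obtain ⟨_, ⟨x, rfl⟩, f, hf, rfl⟩ :=
        Submodule.mem_sup.1 (hYc.sup_eq_top ▸ Submodule.mem_top : y ∈ _)
      obtain ⟨x₁, hx₁, k, hk, rfl⟩ :=
        Submodule.mem_sup.1 (hXc.sup_eq_top ▸ Submodule.mem_top : x ∈ _)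
      refine ⟨(⟨x₁, hx₁⟩, ⟨f, hf⟩), ?_⟩
      rw [hΨa]
      simp [show S₀ k = 0 from hk]
  have key : ∀ S : X →L[ℂ] Y, Function.Bijective (Ψ S) →
      linIndex S.toLinearMap =
        (Module.finrank ℂ S₀.ker : ℤ) - (Module.finrank ℂ S₀.rangeᗮ : ℤ) := by
    intro S hS
    refine linIndex_eq_of_isCompl S.toLinearMap hXc ?_ ⟨?_, ?_⟩
    · intro x hx hSx
      have h1 : Ψ S (⟨x, hx⟩, 0) = Ψ S 0 := by
        rw [hΨa, map_zero]
        simpa using hSx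
      exact congrArg (fun y : S₀.kerᗮ × S₀.rangeᗮ => (y.1 : X)) (hS.1 h1)
    · refine Submodule.disjoint_def.2 ?_
      rintro _ ⟨x, hx, rfl⟩ hf
      have h1 : Ψ S (⟨x, hx⟩, 0) = Ψ S (0, ⟨_, hf⟩) := by
        rw [hΨa, hΨa]
        simp
      have h2 : x = 0 := congrArg (fun y : S₀.kerᗮ × S₀.rangeᗮ => (y.1 : X)) (hS.1 h1)
      simp [h2]
    · refine codisjoint_iff.2 (eq_top_iff.2 fun y _ => ?_)
      obtain ⟨⟨x, f⟩, rfl⟩ := hS.2 y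
      rw [hΨa]
      exact Submodule.add_mem_sup ⟨x, x.2, rfl⟩ f.2
  let e : (S₀.kerᗮ × S₀.rangeᗮ) ≃L[ℂ] Y := ContinuousLinearEquiv.ofBijective (Ψ S₀)
    (LinearMap.ker_eq_bot.2 hbij.1) (LinearMap.range_eq_top.2 hbij.2)
  have he : (e : S₀.kerᗮ × S₀.rangeᗮ →L[ℂ] Y) = Ψ S₀ := by ext <;> rfl
  have hnhds : ∀ᶠ T in 𝓝 (Ψ S₀), T ∈ Set.range
      ((↑) : ((S₀.kerᗮ × S₀.rangeᗮ) ≃L[ℂ] Y) → (S₀.kerᗮ × S₀.rangeᗮ →L[ℂ] Y)) := by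
    rw [← he]
    exact ContinuousLinearEquiv.nhds e
  filter_upwards [hΨ.continuousAt.eventually hnhds] with S hS
  obtain ⟨e', he'⟩ := hS
  rw [key S (by rw [← he']; exact e'.bijective), key S₀ hbij]

end Abstract

/-! ### The operator on the harmonic oscillator space -/

instance : CompleteSpace (OscSpace n m) :=
  (Submodule.isClosed_topologicalClosure _).completeSpace_coe

/-- A test function as an element of `ℋ`. -/
def testOsc (u : testFunctions n m) : OscSpace n m :=
  ⟨oscMap n m u, Submodule.le_topologicalClosure _ ⟨u, rfl⟩⟩

theorem denseRange_testOsc : DenseRange (testOsc (n := n) (m := m)) := by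
  rintro ⟨w, hw⟩
  refine closure_subtype.2 ?_
  convert (show w ∈ closure (Set.range (oscMap n m)) from hw) using 2
  rw [← Set.range_comp]
  rfl

/-- The coordinates `u`, `∂ⱼ u`, `xⱼ u` of an element of `ℋ`. -/
def oscCoord (i : Option (Fin n ⊕ Fin n)) : OscSpace n m →L[ℂ] L2 n m :=
  (PiLp.proj 2 (fun _ : Option (Fin n ⊕ Fin n) => L2 n m) i : _ →L[ℂ] L2 n m) ∘L
    (OscSpace n m).subtypeL

theorem oscToL2_testOsc (u : testFunctions n m) : oscToL2 n m (testOsc u) = toL2 n m u := rfl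

theorem norm_le_sum_oscCoord (w : OscSpace n m) : ‖w‖ ≤ ∑ i, ‖oscCoord i w‖ := by
  rw [Submodule.coe_norm, PiLp.norm_eq_of_L2]
  refine Real.sqrt_le_iff.2 ⟨by positivity, ?_⟩
  exact Finset.sum_sq_le_sq_sum_of_nonneg fun i _ => norm_nonneg _

/-- Pointwise action of matrices on `L²`. -/
def actL : (Cm m →L[ℂ] Cm m) →L[ℂ] L2 n m →L[ℂ] L2 n m :=
  (ContinuousLinearMap.id ℂ (Cm m →L[ℂ] Cm m)).compLpL₂ 2 volume

theorem actL_toL2 (M : Matrix (Fin m) (Fin m) ℂ) (u : testFunctions n m) :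
    actL (mat M) (toL2 n m u) = toL2 n m (mulMat M u) := by
  refine Lp.ext ?_
  refine (ContinuousLinearMap.coeFn_compLp' (mat M) (toL2 n m u)).trans ?_
  filter_upwards [(testFunctions_memLp u).coeFn_toLp,
    (testFunctions_memLp (mulMat M u)).coeFn_toLp] with x h1 h2
  refine Eq.trans ?_ h2.symm
  exact congrArg (mat M) h1

/-- The bounded operator `∑ⱼ Aⱼ ∂ⱼ + ∑ⱼ xⱼ Bⱼ` from `ℋ` to `L²`. -/
def oscOp (A B : Fin n → Matrix (Fin m) (Fin m) ℂ) : OscSpace n m →L[ℂ] L2 n m :=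
  ∑ j, actL (mat (A j)) ∘L oscCoord (some (Sum.inl j)) +
    ∑ j, actL (mat (B j)) ∘L oscCoord (some (Sum.inr j))

theorem oscOp_testOsc (A B : Fin n → Matrix (Fin m) (Fin m) ℂ) (u : testFunctions n m) :
    oscOp A B (testOsc u) = toL2 n m (opTest A B u) := by
  have h1 : ∀ j, oscCoord (some (Sum.inl j)) (testOsc u) = toL2 n m (partialD j u) := fun _ => rfl
  have h2 : ∀ j, oscCoord (some (Sum.inr j)) (testOsc u) = toL2 n m (mulCoord j u) := fun _ => rfl
  simp only [oscOp, opTest, add_apply, sum_apply, ContinuousLinearMap.comp_apply, h1, h2,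
    actL_toL2, LinearMap.add_apply, LinearMap.sum_apply, LinearMap.comp_apply, map_add, map_sum,
    mulCoord_mulMat]

theorem weakEq_oscOp (A B : Fin n → Matrix (Fin m) (Fin m) ℂ) (w : OscSpace n m) :
    WeakEq A B (oscToL2 n m w) (oscOp A B w) :=
  denseRange_testOsc.induction_on (p := fun w => WeakEq A B (oscToL2 n m w) (oscOp A B w)) w
    ((isClosed_weakEq A B).preimage ((oscToL2 n m).continuous.prodMk (oscOp A B).continuous))
    fun u => by
      rw [oscToL2_testOsc, oscOp_testOsc]
      exact weakEq_toL2 A B u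

theorem actL_one (u : L2 n m) : actL (mat 1) u = u := by
  refine Lp.ext ?_
  refine (ContinuousLinearMap.coeFn_compLp' (mat 1) u).trans (ae_of_all _ fun x => ?_)
  simp

/-- Each coordinate of `ℋ` other than `u` itself is given by an operator of the same type. -/
theorem exists_oscOp_eq_oscCoord (i : Fin n ⊕ Fin n) :
    ∃ A B : Fin n → Matrix (Fin m) (Fin m) ℂ, oscOp A B = oscCoord (some i) := by
  rcases i with j | j
  · refine ⟨Pi.single j 1, 0, ?_⟩
    ext1 w
    simp only [oscOp, add_apply, sum_apply, ContinuousLinearMap.comp_apply, Pi.zero_apply,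
      map_zero, zero_apply, Finset.sum_const_zero, add_zero]
    rw [Finset.sum_eq_single j (fun k _ hk => by simp [Pi.single_eq_of_ne hk]) (by simp),
      Pi.single_eq_same, actL_one]
  · refine ⟨0, Pi.single j 1, ?_⟩
    ext1 w
    simp only [oscOp, add_apply, sum_apply, ContinuousLinearMap.comp_apply, Pi.zero_apply,
      map_zero, zero_apply, Finset.sum_const_zero, zero_add]
    rw [Finset.sum_eq_single j (fun k _ hk => by simp [Pi.single_eq_of_ne hk]) (by simp),
      Pi.single_eq_same, actL_one]

/-- Weak derivatives are unique, so `ℋ` is a space of functions. -/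
theorem oscToL2_injective : Function.Injective (oscToL2 n m) := by
  refine (injective_iff_map_eq_zero _).2 fun w hw => ?_
  refine norm_le_zero_iff.1 ((norm_le_sum_oscCoord w).trans_eq (Finset.sum_eq_zero fun i _ => ?_))
  rw [norm_eq_zero]
  rcases i with _ | i
  · exact hw
  · obtain ⟨A, B, h⟩ := exists_oscOp_eq_oscCoord (m := m) i
    have h1 := weakEq_oscOp A B w
    rw [hw, h] at h1
    exact h1.unique fun φ => by simp

/-- The a priori estimate. -/
theorem IsotropicElliptic.exists_norm_le {A B : Fin n → Matrix (Fin m) (Fin m) ℂ}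
    (h : IsotropicElliptic A B) :
    ∃ C : ℝ, 0 ≤ C ∧ ∀ w, ‖w‖ ≤ C * (‖oscOp A B w‖ + ‖oscToL2 n m w‖) := by
  obtain ⟨g, hg⟩ := Window.exists_l2norm_pos n
  obtain ⟨C, hC, hCb⟩ := h.exists_oscSTFT_le g
  have key : ∀ i : Option (Fin n ⊕ Fin n), ∃ c : ℝ, 0 ≤ c ∧
      ∀ w, ‖oscCoord i w‖ ≤ c * (‖oscOp A B w‖ + ‖oscToL2 n m w‖) := by
    intro i
    rcases i with _ | i
    · refine ⟨1, zero_le_one, fun w => ?_⟩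
      rw [one_mul]
      exact le_add_of_nonneg_left (norm_nonneg _)
    · obtain ⟨A', B', h'⟩ := exists_oscOp_eq_oscCoord (m := m) i
      obtain ⟨c, hc, hcb⟩ := WeakEq.exists_norm_le A' B' hg
      refine ⟨c * (C + 1), by positivity, fun w => ?_⟩
      rw [← h']
      refine (hcb _ _ _ (by positivity) (weakEq_oscOp A' B' w)
        (hCb _ _ (weakEq_oscOp A B w))).trans ?_
      rw [mul_assoc, add_mul, one_mul]
      gcongr
      exact le_add_of_nonneg_left (norm_nonneg _)
  choose c hc hcb using key
  refine ⟨∑ i, c i, Finset.sum_nonneg fun i _ => hc i, fun w => ?_⟩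
  rw [Finset.sum_mul]
  exact (norm_le_sum_oscCoord w).trans (Finset.sum_le_sum fun i _ => hcb i w)

/-! ### The closure of the operator -/

theorem mem_graph_opQ (A B : Fin n → Matrix (Fin m) (Fin m) ℂ) (y : L2 n m × L2 n m) :
    y ∈ (opQ A B).graph ↔ ∃ u, (toL2 n m u, toL2 n m (opTest A B u)) = y := by
  rw [LinearPMap.mem_graph_iff]
  constructor
  · rintro ⟨⟨_, u, rfl⟩, h1, h2⟩
    refine ⟨u, Prod.ext h1 (Eq.trans ?_ h2)⟩
    have h : (LinearEquiv.ofInjective (toL2 n m) (toL2_injective n m)).symm ⟨toL2 n m u, u, rfl⟩ =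
        u := by
      rw [LinearEquiv.symm_apply_eq]; rfl
    exact congrArg (fun v => toL2 n m (opTest A B v)) h.symm
  · rintro ⟨u, rfl⟩
    refine ⟨⟨toL2 n m u, u, rfl⟩, rfl, ?_⟩
    have h : (LinearEquiv.ofInjective (toL2 n m) (toL2_injective n m)).symm ⟨toL2 n m u, u, rfl⟩ =
        u := by
      rw [LinearEquiv.symm_apply_eq]; rfl
    exact congrArg (fun v => toL2 n m (opTest A B v)) h

/-- The closure of the graph of `Q` is the graph of `Q` on `ℋ`. -/
theorem IsotropicElliptic.closure_graph {A B : Fin n → Matrix (Fin m) (Fin m) ℂ}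
    (h : IsotropicElliptic A B) :
    (opQ A B).graph.topologicalClosure =
      LinearMap.range ((oscToL2 n m).prod (oscOp A B)).toLinearMap := by
  obtain ⟨C, hC, hCb⟩ := h.exists_norm_le
  set Φ := (oscToL2 n m).prod (oscOp A B) with hΦ
  have hanti : AntilipschitzWith (2 * C).toNNReal Φ := by
    refine ContinuousLinearMap.antilipschitz_of_bound _ fun w => ?_
    rw [Real.coe_toNNReal _ (by positivity)]
    have h1 : ‖oscToL2 n m w‖ ≤ ‖Φ w‖ := norm_fst_le (Φ w)
    have h2 : ‖oscOp A B w‖ ≤ ‖Φ w‖ := norm_snd_le (Φ w)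
    nlinarith [hCb w]
  have hrange : IsClosed (LinearMap.range Φ.toLinearMap : Set (L2 n m × L2 n m)) :=
    hanti.isClosed_range Φ.uniformContinuous
  refine le_antisymm (Submodule.topologicalClosure_minimal _ ?_ hrange) ?_
  · intro y hy
    obtain ⟨u, rfl⟩ := (mem_graph_opQ A B y).1 hy
    exact ⟨testOsc u, Prod.ext rfl (oscOp_testOsc A B u)⟩
  · rintro _ ⟨w, rfl⟩
    refine denseRange_testOsc.induction_on
      (p := fun w => Φ w ∈ (opQ A B).graph.topologicalClosure) w
      ((Submodule.isClosed_topologicalClosure _).preimage Φ.continuous) fun u => ?_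
    exact Submodule.le_topologicalClosure _
      ((mem_graph_opQ A B _).2 ⟨u, Prod.ext rfl (oscOp_testOsc A B u).symm⟩)

theorem IsotropicElliptic.isClosable {A B : Fin n → Matrix (Fin m) (Fin m) ℂ}
    (h : IsotropicElliptic A B) : (opQ A B).IsClosable := by
  refine ⟨(LinearMap.range ((oscToL2 n m).prod (oscOp A B)).toLinearMap).toLinearPMap, ?_⟩
  rw [h.closure_graph, Submodule.toLinearPMap_graph_eq]
  rintro _ ⟨w, rfl⟩ hw
  have : w = 0 := oscToL2_injective (by simpa using hw)
  simp [this]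

theorem IsotropicElliptic.mem_graph_closure {A B : Fin n → Matrix (Fin m) (Fin m) ℂ}
    (h : IsotropicElliptic A B) (y : L2 n m × L2 n m) :
    y ∈ (opQ A B).closure.graph ↔ ∃ w, (oscToL2 n m w, oscOp A B w) = y := by
  rw [← h.isClosable.graph_closure_eq_closure_graph, h.closure_graph]
  rfl

theorem IsotropicElliptic.domain_closure {A B : Fin n → Matrix (Fin m) (Fin m) ℂ}
    (h : IsotropicElliptic A B) :
    (opQ A B).closure.domain = LinearMap.range (oscToL2 n m).toLinearMap := by
  ext x
  rw [LinearPMap.mem_domain_iff]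
  simp only [h.mem_graph_closure, Prod.mk.injEq]
  constructor
  · rintro ⟨_, w, hw, _⟩
    exact ⟨w, hw⟩
  · rintro ⟨w, hw⟩
    exact ⟨_, w, hw, rfl⟩

theorem IsotropicElliptic.closure_apply {A B : Fin n → Matrix (Fin m) (Fin m) ℂ}
    (h : IsotropicElliptic A B) (w : OscSpace n m)
    (hw : oscToL2 n m w ∈ (opQ A B).closure.domain) :
    oscOp A B w = (opQ A B).closure ⟨oscToL2 n m w, hw⟩ := by
  obtain ⟨w', h'⟩ := (h.mem_graph_closure _).1
    ((opQ A B).closure.mem_graph ⟨oscToL2 n m w, hw⟩)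
  rw [Prod.mk.injEq] at h'
  rw [← h'.2, oscToL2_injective h'.1]

theorem IsotropicElliptic.index_closure {A B : Fin n → Matrix (Fin m) (Fin m) ℂ}
    (h : IsotropicElliptic A B) :
    index (opQ A B).closure = linIndex (oscOp A B).toLinearMap := by
  have hdom : ∀ w, oscToL2 n m w ∈ (opQ A B).closure.domain := fun w => by
    rw [h.domain_closure]; exact ⟨w, rfl⟩
  let e : OscSpace n m →ₗ[ℂ] (opQ A B).closure.domain :=
    (oscToL2 n m).toLinearMap.codRestrict _ hdom
  have he : Function.Bijective e := by
    refine ⟨fun w w' hw => oscToL2_injective (congrArg Subtype.val hw), ?_⟩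
    rintro ⟨x, hx⟩
    obtain ⟨w, hw⟩ := h.domain_closure.le hx
    exact ⟨w, Subtype.ext hw⟩
  let E := LinearEquiv.ofBijective e he
  have hS : (oscOp A B).toLinearMap = (opQ A B).closure.toFun ∘ₗ E.toLinearMap :=
    LinearMap.ext fun w => h.closure_apply w (hdom w)
  rw [index, linIndex, hS, LinearEquiv.range_comp, LinearMap.ker_comp]
  congr 2
  exact ((E.submoduleMap _).finrank_eq.trans
    (by rw [Submodule.map_comap_eq_of_surjective E.surjective])).symm

/-! ### Ellipticity -/

theorem mat_pencil (M : Fin n → Matrix (Fin m) (Fin m) ℂ) (x : Rn n) :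
    mat (pencil M x) = ∑ k, (x k : ℂ) • mat (M k) := by
  simp only [mat, pencil, map_sum, map_smul]

theorem sym_eq_pencil (A B : Fin n → Matrix (Fin m) (Fin m) ℂ) (z : Rn n × Rn n) :
    sym A B z = (2 * Real.pi * Complex.I) • mat (pencil A z.2) + mat (pencil B z.1) := by
  simp only [mat_pencil, sym, Finset.smul_sum, smul_smul]

theorem pencil_conjTranspose_mul (A B : Fin n → Matrix (Fin m) (Fin m) ℂ)
    (hAB : ∀ j k, (A j)ᴴ * B k - (B k)ᴴ * A j = 0) (p q : Rn n) :
    (pencil A p)ᴴ * pencil B q = (pencil B q)ᴴ * pencil A p := by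
  simp only [pencil, Matrix.conjTranspose_sum, Matrix.conjTranspose_smul, Finset.sum_mul_sum,
    smul_mul_smul_comm, RCLike.star_def, Complex.conj_ofReal]
  rw [Finset.sum_comm]
  refine Finset.sum_congr rfl fun k _ => Finset.sum_congr rfl fun j _ => ?_
  rw [sub_eq_zero.1 (hAB j k), mul_comm]

theorem eq_zero_of_isUnit {M : Matrix (Fin m) (Fin m) ℂ} (hM : IsUnit M) {v : Cm m}
    (hv : mat M v = 0) : v = 0 := by
  obtain ⟨N, hN⟩ := hM.exists_left_inv
  have h : mat (N * M) v = mat N (mat M v) := by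
    rw [mat, map_mul]; rfl
  rw [hN, hv, map_zero] at h
  simpa using h

/-- By the commutation relation `⟨A(p) v, B(q) v⟩` is real, so `2πi A(p) v + B(q) v = 0` forces
`A(p) v = B(q) v = 0`. -/
theorem isotropicElliptic {A B : Fin n → Matrix (Fin m) (Fin m) ℂ} (hA : IsElliptic A)
    (hB : ∀ x : Rn n, x ≠ 0 → IsUnit (pencil B x))
    (hAB : ∀ j k, (A j)ᴴ * B k - (B k)ᴴ * A j = 0) : IsotropicElliptic A B := by
  intro z hz v hv
  set a := mat (pencil A z.2) v with ha
  set b := mat (pencil B z.1) v with hb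
  have hab : inner ℂ a b = inner ℂ b a := by
    rw [ha, hb, ← inner_mat_conjTranspose, ← inner_mat_conjTranspose]
    have h : ∀ M N : Matrix (Fin m) (Fin m) ℂ, mat M (mat N v) = mat (M * N) v := fun M N => by
      rw [mat, mat, mat, map_mul]; rfl
    rw [h, h, pencil_conjTranspose_mul B A (fun j k => ?_)]
    rw [← neg_eq_zero, neg_sub]
    exact hAB k j
  have hsum : b = -(2 * Real.pi * Complex.I) • a := by
    rw [sym_eq_pencil] at hv
    rw [neg_smul]
    exact eq_neg_of_add_eq_zero_right hv
  have ha0 : a = 0 := by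
    rw [hsum, inner_smul_left, inner_smul_right] at hab
    rw [← inner_self_eq_zero (𝕜 := ℂ)]
    have h2 : (4 * Real.pi * Complex.I) * inner ℂ a a = 0 := by
      simp only [map_neg, map_mul, map_ofNat, Complex.conj_ofReal, Complex.conj_I] at hab
      linear_combination -hab
    exact (mul_eq_zero.1 h2).resolve_left (by simp [Real.pi_ne_zero])
  have hb0 : b = 0 := by rw [hsum, ha0, smul_zero]
  by_cases hp : z.2 = 0
  · have hq : z.1 ≠ 0 := fun hq => hz (Prod.ext hq hp)
    exact eq_zero_of_isUnit (hB _ hq) hb0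
  · exact eq_zero_of_isUnit (hA _ hp) ha0

theorem isUnit_pencil_of_posSemidef {B : Fin n → Matrix (Fin m) (Fin m) ℂ} {K : ℝ} (hK : 0 < K)
    (hB : ∀ x : Rn n, ((pencil B x)ᴴ * pencil B x
      - ((K * ‖x‖ ^ 2 : ℝ) : ℂ) • (1 : Matrix (Fin m) (Fin m) ℂ)).PosSemidef)
    (x : Rn n) (hx : x ≠ 0) : IsUnit (pencil B x) := by
  rw [← Matrix.mulVec_injective_iff_isUnit]
  refine (injective_iff_map_eq_zero (pencil B x).mulVecLin).2 fun v hv => ?_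
  have hv' : pencil B x *ᵥ v = 0 := hv
  have h := (hB x).dotProduct_mulVec_nonneg v
  rw [Matrix.sub_mulVec, ← Matrix.mulVec_mulVec, hv', Matrix.mulVec_zero, zero_sub,
    Matrix.smul_mulVec, Matrix.one_mulVec, dotProduct_neg, dotProduct_smul, smul_eq_mul,
    neg_nonneg] at h
  have hpos : (0 : ℂ) < ((K * ‖x‖ ^ 2 : ℝ) : ℂ) := by
    rw [Complex.zero_lt_real]
    have := norm_pos_iff.2 hx
    positivity
  have h0 : 0 ≤ star v ⬝ᵥ v := dotProduct_star_self_nonneg v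
  have h1 := le_antisymm h (mul_nonneg hpos.le h0)
  exact dotProduct_star_self_eq_zero.1 ((mul_eq_zero.1 h1).resolve_left hpos.ne')

/-- Square injective symbols are surjective, so the formal adjoint is elliptic as well. -/
theorem IsotropicElliptic.adjoint {A B : Fin n → Matrix (Fin m) (Fin m) ℂ}
    (h : IsotropicElliptic A B) :
    IsotropicElliptic (fun k => -(A k)ᴴ) (fun k => (B k)ᴴ) := by
  intro z hz v hv
  have hinj : Function.Injective (sym A B z).toLinearMap :=
    (injective_iff_map_eq_zero _).2 fun w hw => h z hz w hw
  obtain ⟨w, hw⟩ := (LinearMap.injective_iff_surjective.1 hinj) v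
  rw [← inner_self_eq_zero (𝕜 := ℂ)]
  nth_rw 2 [← hw]
  change inner ℂ v (sym A B z w) = 0
  rw [← inner_sym_adjoint, hv, inner_zero_left]

/-! ### The Fredholm property and the index -/

theorem IsotropicElliptic.isFredholm_oscOp {A B : Fin n → Matrix (Fin m) (Fin m) ℂ}
    (h : IsotropicElliptic A B) : (oscOp A B).IsFredholm := by
  obtain ⟨F, hF, hF', C, hC, hCb⟩ := h.exists_cofg_bound
  obtain ⟨F₂, -, hF₂, C₂, -, hC₂⟩ := h.adjoint.exists_cofg_bound
  obtain ⟨C₁, hC₁, hC₁b⟩ := h.exists_norm_le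
  have hcofg : (F.comap (oscToL2 n m).toLinearMap).CoFG := by
    have : Module.Finite ℂ (L2 n m ⧸ F) := hF'
    have h1 := Submodule.CoFG.ker (F.mkQ ∘ₗ (oscToL2 n m).toLinearMap)
    rwa [LinearMap.ker_comp, Submodule.ker_mkQ] at h1
  refine isFredholm_of_bounded_below (oscOp A B) (hF.preimage (oscToL2 n m).continuous) hcofg
    (C := C₁ * (1 + C)) (by positivity) (fun w hw => ?_) ?_
  · have h1 := hCb _ hw _ (weakEq_oscOp A B w)
    refine (hC₁b w).trans ?_
    rw [mul_assoc, add_mul, one_mul]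
    gcongr
    exact h1
  · rw [← Submodule.fg_iff_finiteDimensional]
    refine hF₂.fg_of_disjoint (Submodule.disjoint_def.2 fun v hv hv' => ?_)
    have hweak : WeakEq (fun k => -(A k)ᴴ) (fun k => (B k)ᴴ) v 0 := by
      intro φ
      simp only [Matrix.conjTranspose_neg, Matrix.conjTranspose_conjTranspose, neg_neg,
        inner_zero_right, ← oscOp_testOsc]
      exact hv _ ⟨_, rfl⟩
    have h1 := hC₂ v hv' 0 hweak
    rw [norm_zero, mul_zero] at h1
    exact norm_le_zero_iff.1 h1

theorem IsotropicElliptic.isFredholmOnOsc {A B : Fin n → Matrix (Fin m) (Fin m) ℂ}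
    (h : IsotropicElliptic A B) : IsFredholmOnOsc (opQ A B).closure :=
  ⟨oscToL2_injective, h.domain_closure, oscOp A B, h.closure_apply, h.isFredholm_oscOp⟩

theorem continuous_oscOp {T : Type*} [TopologicalSpace T]
    {A B : T → Fin n → Matrix (Fin m) (Fin m) ℂ} (hA : ∀ j, Continuous fun t => A t j)
    (hB : ∀ j, Continuous fun t => B t j) : Continuous fun t => oscOp (A t) (B t) := by
  have hmat : Continuous (mat (m := m)) :=
    LinearMap.continuous_of_finiteDimensional
      ({ toFun := mat, map_add' := map_add _, map_smul' := map_smul _ } :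
        Matrix (Fin m) (Fin m) ℂ →ₗ[ℂ] Cm m →L[ℂ] Cm m)
  have h1 : ∀ M : T → Matrix (Fin m) (Fin m) ℂ, Continuous M →
      Continuous fun t => actL (n := n) (mat (M t)) := fun M hM =>
    actL.continuous.comp (hmat.comp hM)
  unfold oscOp
  exact (continuous_finsetSum _ fun j _ => (h1 _ (hA j)).clm_comp continuous_const).add
    (continuous_finsetSum _ fun j _ => (h1 _ (hB j)).clm_comp continuous_const)

theorem linIndex_oscOp_eq {T : Type*} [TopologicalSpace T] [PreconnectedSpace T]
    {A B : T → Fin n → Matrix (Fin m) (Fin m) ℂ} (hA : ∀ j, Continuous fun t => A t j)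
    (hB : ∀ j, Continuous fun t => B t j) (h : ∀ t, IsotropicElliptic (A t) (B t)) (s t : T) :
    linIndex (oscOp (A s) (B s)).toLinearMap = linIndex (oscOp (A t) (B t)).toLinearMap := by
  have hloc : IsLocallyConstant fun t => linIndex (oscOp (A t) (B t)).toLinearMap :=
    (IsLocallyConstant.iff_eventually_eq _).2 fun t =>
      (continuous_oscOp hA hB).continuousAt.eventually
        (eventually_linIndex_eq (h t).isFredholm_oscOp)
  exact hloc.apply_eq_of_preconnectedSpace s t

end LocalIndex

end

theorem proposition4p2 (n m : ℕ) :
    (∀ A B : Fin n → Matrix (Fin m) (Fin m) ℂ,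
      LocalIndex.IsElliptic A →
      (∃ K : ℝ, 0 < K ∧ ∀ x : LocalIndex.Rn n,
        ((LocalIndex.pencil B x)ᴴ * LocalIndex.pencil B x
          - ((K * ‖x‖ ^ 2 : ℝ) : ℂ) • (1 : Matrix (Fin m) (Fin m) ℂ)).PosSemidef) →
      (∀ j k, (A j)ᴴ * B k - (B k)ᴴ * A j = 0) →
      (LocalIndex.opQ A B).IsClosable ∧
        LocalIndex.IsFredholmOnOsc (LocalIndex.opQ A B).closure) ∧
    (∀ A B : unitInterval → Fin n → Matrix (Fin m) (Fin m) ℂ,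
      (∀ j, Continuous fun t => A t j) →
      (∀ j, Continuous fun t => B t j) →
      (∀ t, ∀ x : LocalIndex.Rn n, x ≠ 0 →
        IsUnit (LocalIndex.pencil (A t) x) ∧ IsUnit (LocalIndex.pencil (B t) x)) →
      (∀ t j k, (A t j)ᴴ * B t k - (B t k)ᴴ * A t j = 0) →
      (∀ t, (LocalIndex.opQ (A t) (B t)).IsClosable ∧
        LocalIndex.IsFredholmOnOsc (LocalIndex.opQ (A t) (B t)).closure) ∧
      ∀ s t, LocalIndex.index (LocalIndex.opQ (A s) (B s)).closure =
        LocalIndex.index (LocalIndex.opQ (A t) (B t)).closure) := by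
  refine ⟨fun A B hA ⟨K, hK, hB⟩ hAB => ?_, fun A B hAc hBc hu hAB => ?_⟩
  · have h := LocalIndex.isotropicElliptic hA (LocalIndex.isUnit_pencil_of_posSemidef hK hB) hAB
    exact ⟨h.isClosable, h.isFredholmOnOsc⟩
  · have h : ∀ t, LocalIndex.IsotropicElliptic (A t) (B t) := fun t =>
      LocalIndex.isotropicElliptic (fun x hx => (hu t x hx).1) (fun x hx => (hu t x hx).2) (hAB t)
    refine ⟨fun t => ⟨(h t).isClosable, (h t).isFredholmOnOsc⟩, fun s t => ?_⟩
    rw [(h s).index_closure, (h t).index_closure]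
    exact LocalIndex.linIndex_oscOp_eq hAc hBc h s t
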